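/- **Theorem (limit of $\hat q_n(\pi)$).** For $h\in\mathbb N$ and $x=(x_0,\dots,x_h)\in\mathbb R^{h+1}$ let the ordinal pattern $\Pi(x_0,\dots,x_h)=(\pi_0,\dots,\pi_h)$ be the permutation of $\{0,\dots,h\}$ with $x_{\pi_0}\ge x_{\pi_1}\ge\dots\ge x_{\pi_h}$ and $\pi_{i-1}>\pi_i$ whenever $x_{\pi_{i-1}}=x_{\pi_i}$, $1\le i\le h$. For $x=(x_1,\dots,x_h)\in\mathbb R^h$ put $\tilde\Pi(x_1,\dots,x_h)=\Pi(0,x_1,x_1+x_2,\dots,x_1+\dots+x_h)$. Let $(\xi_t)_{t\ge 0}$ be a real-valued stochastic process whose increments $X_t=\xi_t-\xi_{t-1}$, $t\ge 1$, form a stationary Gaussian process with standard normal marginals and long-range dependent autocovariances $$r(k)=\operatorname{Cov}(X_1,X_{1+k})=L(k)\,k^{-D},\qquad k\ge 1,$$ where $0<D<1$ and $L$ is slowly varying at infinity, that is, $L$ is measurable and positive on some half-line $[a,\infty)$ and $L(\lambda x)/L(x)\to 1$ as $x\to\infty$ for every $\lambda>0$. Let $\pi$ be a permutation of $\{0,\dots,h\}$,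 and let $$\hat q_n(\pi)=\frac1n\,\#\{0\le i\le n-1:\ \Pi(\xi_i,\dots,\xi_{i+h})=\pi\},\qquad p(\pi)=\mathbb P\big(\tilde\Pi(X_1,\dots,X_h)=\pi\big).$$ Let $\Sigma_h$ be the covariance matrix of $(X_1,\dots,X_h)$ and let $c=(c_1,\dots,c_h)^t$ with $c_k=\mathbb E\big[\mathbf 1_{\{\tilde\Pi(X_1,\dots,X_h)=\pi\}}X_k\big]$. Then $\Sigma_h$ is invertible and, with $\alpha=(\alpha_1,\dots,\alpha_h)^t=\Sigma_h^{-1}c$ and $c_D=\dfrac{2}{(1-D)(2-D)}$, $$n^{D/2}L^{-1/2}(n)\,\big(\hat q_n(\pi)-p(\pi)\big)\ \xrightarrow{\ \mathcal D\ }\ \mathcal N\Big(0,\;c_D\Big(\sum_{j=1}^h\alpha_j\Big)^2\Big)\qquad (n\to\infty),$$ where $\mathcal N(0,0)$ denotes the point mass at $0$. -/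

import Mathlib

open MeasureTheory ProbabilityTheory Filter
open scoped Topology

namespace OrdinalPatterns

/-- `L` is slowly varying at infinity: it is positive and measurable on some half-line `[a, ∞)`,
and `L (c x) / L x → 1` as `x → ∞` for every `c > 0`. -/
def IsSlowlyVarying (L : ℝ → ℝ) : Prop :=
  (∃ a : ℝ, Measurable ((Set.Ici a).domRestrict L) ∧ ∀ x, a ≤ x → 0 < L x) ∧
    ∀ c : ℝ, 0 < c → Tendsto (fun x => L (c * x) / L x) atTop (𝓝 1)

/-- Strict stationarity of a real process indexed by `ℕ`: all time shifts of the process have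
the same law on the sequence space. -/
def IsStationaryProcess {Ω : Type*} [MeasurableSpace Ω] (X : ℕ → Ω → ℝ) (P : Measure Ω) : Prop :=
  ∀ k : ℕ, IdentDistrib (fun ω t => X (t + k) ω) (fun ω t => X t ω) P P

/-- A stationary Gaussian process all of whose marginals are standard normal. -/
structure IsStationaryStandardGaussian {Ω : Type*} [MeasurableSpace Ω]
    (X : ℕ → Ω → ℝ) (P : Measure Ω) : Prop where
  gaussian : IsGaussianProcess X P
  stationary : IsStationaryProcess X P
  standard : ∀ t, HasLaw (X t) (gaussianReal 0 1) P

/-- The increments of `ξ`. The index starts at `0`: `increments ξ t` is the increment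
`ξ_{t+1} - ξ_t`, usually denoted `X_{t+1}`. -/
def increments {Ω : Type*} (ξ : ℕ → Ω → ℝ) (t : ℕ) (ω : Ω) : ℝ := ξ (t + 1) ω - ξ t ω

/-- The ordinal pattern `Π(x_0, …, x_h)`: the permutation which lists the indices in decreasing
order of their values, and, among equal values, in decreasing order of the indices
(see `ordinalPattern_eq_iff`). `Tuple.sort x` is the stable increasing sort; it is read backwards. -/
noncomputable def ordinalPattern {h : ℕ} (x : Fin (h + 1) → ℝ) : Equiv.Perm (Fin (h + 1)) :=
  Fin.revPerm.trans (Tuple.sort x)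

/-- `Π(x) = π` iff `x_{π_0} ≥ … ≥ x_{π_h}`, where `π_i > π_{i+1}` if `x_{π_i} = x_{π_{i+1}}`. -/
theorem ordinalPattern_eq_iff {h : ℕ} (x : Fin (h + 1) → ℝ) (π : Equiv.Perm (Fin (h + 1))) :
    ordinalPattern x = π ↔ ∀ i : Fin h, x (π i.castSucc) ≥ x (π i.succ) ∧
      (x (π i.castSucc) = x (π i.succ) → π i.castSucc > π i.succ) := by
  have key : ordinalPattern x = π ↔ Fin.revPerm.trans π = Tuple.sort x := by
    unfold ordinalPattern
    constructor
    · rintro rfl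
      ext i
      simp
    · intro e
      rw [← e]
      ext i
      simp
  have lexdef : Fin.revPerm.trans π = Tuple.sort x ↔
      StrictAnti (fun i => (toLex (x (π i), π i) : ℝ ×ₗ Fin (h + 1))) := by
    rw [Tuple.eq_sort_iff']
    constructor
    · intro hm i j hij
      have := hm (Fin.rev_lt_rev.mpr hij)
      have h2 : ((Tuple.graphEquiv₁ x) (π (Fin.rev (Fin.rev j)))).1
          < ((Tuple.graphEquiv₁ x) (π (Fin.rev (Fin.rev i)))).1 := this
      rw [Fin.rev_rev, Fin.rev_rev] at h2
      exact h2
    · intro ha i j hij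
      exact ha (Fin.rev_lt_rev.mpr hij)
  rw [key, lexdef, Fin.strictAnti_iff_succ_lt]
  refine forall_congr' fun i => ?_
  rw [Prod.Lex.toLex_lt_toLex]
  constructor
  · rintro (hl | ⟨he, hl⟩)
    · exact ⟨hl.le, fun e => absurd e hl.ne'⟩
    · exact ⟨he.le, fun _ => hl⟩
  · rintro ⟨hge, ht⟩
    rcases hge.lt_or_eq with hl | he
    · exact Or.inl hl
    · exact Or.inr ⟨he, ht he.symm⟩

/-- The ordinal pattern `Π(0, x_1, x_1 + x_2, …, x_1 + … + x_h)` of a vector of increments. -/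
noncomputable def incrementPattern {h : ℕ} (x : Fin h → ℝ) : Equiv.Perm (Fin (h + 1)) :=
  ordinalPattern fun i => ∑ j : Fin h with j.castSucc < i, x j

/-- The relative frequency of the pattern `π` among the first `n` windows of length `h + 1`
of the time series `ξ`. -/
noncomputable def patternFrequency {Ω : Type*} {h : ℕ} (ξ : ℕ → Ω → ℝ)
    (π : Equiv.Perm (Fin (h + 1))) (n : ℕ) (ω : Ω) : ℝ :=
  (1 / (n : ℝ)) * ∑ i ∈ Finset.range n,
    if ordinalPattern (fun j : Fin (h + 1) => ξ (i + j) ω) = π then (1 : ℝ) else 0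

/-- The event that the increments `X_1, …, X_h` (with Lean indices `0, …, h - 1`) have pattern
`π`. -/
def patternEvent {Ω : Type*} {h : ℕ} (X : ℕ → Ω → ℝ) (π : Equiv.Perm (Fin (h + 1))) : Set Ω :=
  {ω | incrementPattern (fun j : Fin h => X j ω) = π}

/-- The covariance matrix of `(X_1, …, X_h)`. -/
noncomputable def covMatrix {Ω : Type*} [MeasurableSpace Ω] (X : ℕ → Ω → ℝ) (P : Measure Ω)
    (h : ℕ) : Matrix (Fin h) (Fin h) ℝ :=
  Matrix.of fun i j => cov[X i, X j; P]

/-- The vector `c` with entries `c_k = E[1{pattern of (X_1, …, X_h) is π} X_k]`. -/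
noncomputable def patternCoeff {Ω : Type*} [MeasurableSpace Ω] {h : ℕ} (X : ℕ → Ω → ℝ)
    (P : Measure Ω) (π : Equiv.Perm (Fin (h + 1))) : Fin h → ℝ :=
  fun k => ∫ ω, (patternEvent X π).indicator (fun _ => (1 : ℝ)) ω * X k ω ∂P

/-- The vector `α = Σ_h⁻¹ c`. -/
noncomputable def patternAlpha {Ω : Type*} [MeasurableSpace Ω] {h : ℕ} (X : ℕ → Ω → ℝ)
    (P : Measure Ω) (π : Equiv.Perm (Fin (h + 1))) : Fin h → ℝ :=
  Matrix.mulVec (covMatrix X P h)⁻¹ (patternCoeff X P π)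

end OrdinalPatterns

open OrdinalPatterns

open MeasureTheory ProbabilityTheory Filter
open scoped Topology

namespace OrdinalPatterns

/-! Ordinal patterns do not change when a constant is added, so the pattern frequency is an average
of `f` over the windows of increments, where `f` is the indicator of a pattern set. In `L²` of the
window law, `f - p` is split into its linear projection `∑ αⱼ xⱼ`, with `Σ α = c` as normal
equations, and a residual `g` orthogonal to all affine functions, that is, of Hermite rank at least
two.

Linear part. Summed over the windows it equals `(∑ αⱼ) S_n`, with `S_n` the partial sum of the
increments, up to boundary terms bounded in `L²` (`integral_sq_sum_window_sub_le`). `S_n` is exactly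
Gaussian, and Karamata's theorem gives `Var S_n ~ c_D n² r(n)` (`tendsto_variance_sum_div`). Since
`D < 1`, `n² r(n)` tends to infinity and the boundary terms disappear.

Residual. The covariance of `g` at lag `k` is `O(r(k)²) = o(r(k))`, so its partial sums have second
moment `o(n² r(n))` (`tendsto_integral_sq_sum_div`). The square of the normalisation is `1 / (n²
r(n))`, and Slutsky's theorem concludes.

The quadratic covariance bound is obtained without Hermite expansions. After whitening, two windows
form a Gaussian vector `√(1 - s²) a + s w`, where `a` is standard and independent of `w`, and `w`
carries all the cross-correlation, with `s²` of the order of the cross-covariances. Given `w` the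
two halves are independent, so the covariance is the mean of a product of two Ornstein-Uhlenbeck
averages of `g`. The kernel of this average is the Mehler density; orthogonality of `g` removes its
affine part, and Cauchy-Schwarz leaves a factor of order `s⁴`
(`abs_integral_mul_le_of_hasGaussianLaw`).

Invertibility of `Σ_h`: a linear relation would, by stationarity, confine the whole process to a
finite-dimensional space, which is incompatible with `r(k) → 0` (`linearIndependent_of_stationary`).
-/

/-! ### Slowly varying functions -/

/-- The points `s ∈ [0, 2]` at which all later increments of `f` along `y` are below `δ`. -/
def smallIncrementSet (f : ℝ → ℝ) (y : ℕ → ℝ) (δ : ℝ) (n : ℕ) : Set ℝ :=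
  Set.Icc 0 2 ∩ ⋂ m ≥ n, {s | |f (y m + s) - f (y m)| < δ}

theorem measurableSet_smallIncrementSet {f : ℝ → ℝ} (hf : Measurable f) (y : ℕ → ℝ) (δ : ℝ)
    (n : ℕ) : MeasurableSet (smallIncrementSet f y δ n) := by
  refine measurableSet_Icc.inter (MeasurableSet.iInter fun m => MeasurableSet.iInter fun _ => ?_)
  exact measurableSet_lt (by fun_prop) measurable_const

/-- The sets increase to `[0, 2]`, of measure 2. The threshold `3 / 2` is what forces two such sets
to meet when one is translated by at most 1: both then lie in `[0, 3]`. -/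
theorem eventually_lt_volume_smallIncrementSet {f : ℝ → ℝ} {y : ℕ → ℝ} (hy : Tendsto y atTop atTop)
    (h : ∀ u, Tendsto (fun x => f (x + u) - f x) atTop (𝓝 0)) {δ : ℝ} (hδ : 0 < δ) :
    ∀ᶠ n in atTop, ENNReal.ofReal (3 / 2) < volume (smallIncrementSet f y δ n) := by
  have hmono : Monotone (smallIncrementSet f y δ) := by
    intro n k hnk s hs
    refine ⟨hs.1, ?_⟩
    have h2 := hs.2
    simp only [Set.mem_iInter, Set.mem_ofPred_eq] at h2 ⊢
    exact fun m hm => h2 m (le_trans hnk hm)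
  have hun : ⋃ n, smallIncrementSet f y δ n = Set.Icc 0 2 := by
    refine Set.Subset.antisymm (Set.iUnion_subset fun n => Set.inter_subset_left) fun s hs => ?_
    have := ((h s).comp hy).eventually (Metric.ball_mem_nhds 0 hδ)
    obtain ⟨n, hn⟩ := eventually_atTop.1 this
    refine Set.mem_iUnion.2 ⟨n, hs, ?_⟩
    simp only [Set.mem_iInter, Set.mem_ofPred_eq]
    intro m hm
    simpa using hn m hm
  have := tendsto_measure_iUnion_atTop (μ := volume) hmono
  rw [hun, Real.volume_Icc] at this
  exact this.eventually_const_lt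
    ((ENNReal.ofReal_lt_ofReal_iff (by norm_num)).2 (by norm_num))

/-- The uniform convergence theorem for slowly varying functions, in additive form. -/
theorem exists_forall_abs_sub_lt {f : ℝ → ℝ} (hf : Measurable f)
    (h : ∀ u, Tendsto (fun x => f (x + u) - f x) atTop (𝓝 0)) {ε : ℝ} (hε : 0 < ε) :
    ∃ X, ∀ x ≥ X, ∀ u ∈ Set.Icc (0 : ℝ) 1, |f (x + u) - f x| < ε := by
  by_contra! hcon
  choose x hx u hu hxu using fun n : ℕ => hcon n
  have hxt : Tendsto x atTop atTop := tendsto_atTop_mono hx tendsto_natCast_atTop_atTop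
  have hxut : Tendsto (fun n => x n + u n) atTop atTop :=
    tendsto_atTop_mono (fun n => by linarith [(hu n).1]) hxt
  obtain ⟨n, hV, hW⟩ := ((eventually_lt_volume_smallIncrementSet hxt h (half_pos hε)).and
    (eventually_lt_volume_smallIncrementSet hxut h (half_pos hε))).exists
  set V := smallIncrementSet f x (ε / 2) n
  set W := smallIncrementSet f (fun n => x n + u n) (ε / 2) n
  have hWm : MeasurableSet W := measurableSet_smallIncrementSet hf _ _ _
  have hW' : volume ((fun s => s - u n) ⁻¹' W) = volume W :=
    (measurePreserving_sub_right volume (u n)).measure_preimage hWm.nullMeasurableSet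
  -- Two subsets of `[0, 3]` of measure above `3 / 2` share a point `s`. The value `f (x n + s)` is
  -- then within `ε / 2` of both `f (x n)` and `f (x n + u n)`.
  obtain ⟨s, hsV, hsW⟩ := nonempty_inter_of_measure_lt_add volume
    (s := V) (t := (fun s => s - u n) ⁻¹' W) (u := Set.Icc 0 3)
    (hWm.preimage (by fun_prop)) (fun s hs => ⟨hs.1.1, by linarith [hs.1.2]⟩)
    (fun s hs => ⟨by linarith [hs.1.1, (hu n).1], by linarith [hs.1.2, (hu n).2]⟩) (by
      rw [hW', Real.volume_Icc]
      calc ENNReal.ofReal (3 - 0) = ENNReal.ofReal (3 / 2) + ENNReal.ofReal (3 / 2) := by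
            rw [← ENNReal.ofReal_add (by norm_num) (by norm_num)]; norm_num
        _ < _ := ENNReal.add_lt_add hV hW)
  have h1 : |f (x n + s) - f (x n)| < ε / 2 := by
    have := hsV.2
    simp only [Set.mem_iInter, Set.mem_ofPred_eq] at this
    exact this n le_rfl
  have h2 : |f (x n + u n + (s - u n)) - f (x n + u n)| < ε / 2 := by
    have := hsW.2
    simp only [Set.mem_iInter, Set.mem_ofPred_eq] at this
    exact this n le_rfl
  rw [show x n + u n + (s - u n) = x n + s by ring] at h2
  have h3 := hxu n
  rw [abs_lt] at h1 h2
  have : |f (x n + u n) - f (x n)| < ε := abs_lt.2 ⟨by linarith, by linarith⟩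
  linarith

/-- Uniform smallness over unit steps is chained; the number of steps is `⌈y - x⌉₊ ≤ y - x + 1`. -/
theorem exists_forall_abs_sub_le {f : ℝ → ℝ} (hf : Measurable f)
    (h : ∀ u, Tendsto (fun x => f (x + u) - f x) atTop (𝓝 0)) {ε : ℝ} (hε : 0 < ε) :
    ∃ X, ∀ x y, X ≤ x → x ≤ y → |f y - f x| ≤ ε * (y - x + 1) := by
  obtain ⟨X, hX⟩ := exists_forall_abs_sub_lt hf h hε
  have key : ∀ n : ℕ, ∀ x y, X ≤ x → x ≤ y → y ≤ x + n → |f y - f x| ≤ ε * n := by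
    intro n
    induction n with
    | zero =>
      intro x y _ h2 h3
      have : y = x := le_antisymm (by simpa using h3) h2
      simp [this]
    | succ n ih =>
      intro x y h1 h2 h3
      push_cast at h3 ⊢
      rcases le_total y (x + 1) with hy | hy
      · have := hX x h1 (y - x) ⟨by linarith, by linarith⟩
        rw [add_sub_cancel] at this
        nlinarith [(Nat.cast_nonneg n : (0 : ℝ) ≤ n)]
      · have h4 := ih (x + 1) y (by linarith) hy (by linarith)
        have h5 := hX x h1 1 ⟨by norm_num, le_rfl⟩
        calc |f y - f x| ≤ |f y - f (x + 1)| + |f (x + 1) - f x| := abs_sub_le _ _ _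
          _ ≤ _ := by linarith
  refine ⟨X, fun x y h1 h2 => (key ⌈y - x⌉₊ x y h1 h2 ?_).trans ?_⟩
  · linarith [Nat.le_ceil (y - x)]
  · exact mul_le_mul_of_nonneg_left (Nat.ceil_lt_add_one (by linarith)).le hε.le

/-- Potter's bound together with the uniform convergence theorem. -/
theorem IsSlowlyVarying.exists_abs_log_div_le {L : ℝ → ℝ} (hL : IsSlowlyVarying L) {ε : ℝ}
    (hε : 0 < ε) : ∃ N : ℝ, 1 ≤ N ∧ (∀ x, N ≤ x → 0 < L x) ∧ ∀ x y, N ≤ x → x ≤ y →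
      |Real.log (L y / L x)| ≤ ε * (Real.log (y / x) + 1) := by
  obtain ⟨⟨a, hmeas, hpos⟩, hlim⟩ := hL
  classical
  -- `L` is measurable only on `[a, ∞)`; replacing it by 1 below `a` does not affect the limits. The
  -- passage to `log ∘ L' ∘ exp` makes the multiplicative condition additive.
  set L' : ℝ → ℝ := (Set.Ici a).piecewise L 1 with hL'
  have hL'm : Measurable L' := by
    refine measurable_of_restrict_of_restrict_compl measurableSet_Ici (s := Set.Ici a) ?_ ?_
    · convert hmeas using 1
      ext x
      simp [hL', Set.domRestrict]
    · convert (measurable_const (a := (1 : ℝ))) using 1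
      ext x
      exact Set.piecewise_eq_of_notMem _ _ _ x.2
  have hLL : ∀ x, a ≤ x → L' x = L x := fun x hx => Set.piecewise_eq_of_mem _ _ _ hx
  set f : ℝ → ℝ := fun t => Real.log (L' (Real.exp t)) with hfdef
  have hf : Measurable f := by fun_prop
  have hfl : ∀ u, Tendsto (fun x => f (x + u) - f x) atTop (𝓝 0) := by
    intro u
    have h1 := (hlim (Real.exp u) (Real.exp_pos u)).comp Real.tendsto_exp_atTop
    have h2 := (Real.continuousAt_log one_ne_zero).tendsto.comp h1
    rw [Real.log_one] at h2
    refine h2.congr' ?_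
    have h3 : ∀ᶠ t in atTop, a ≤ Real.exp t := Real.tendsto_exp_atTop.eventually_ge_atTop a
    have h4 : ∀ᶠ t in atTop, a ≤ Real.exp (t + u) :=
      (Real.tendsto_exp_atTop.comp (tendsto_atTop_add_const_right _ u tendsto_id)).eventually_ge_atTop a
    filter_upwards [h3, h4] with t h3 h4
    simp only [Function.comp, hfdef]
    rw [hLL _ h3, hLL _ h4, Real.exp_add, mul_comm (Real.exp u), Real.log_div]
    · rw [← Real.exp_add]; exact (hpos _ h4).ne'
    · exact (hpos _ h3).ne'
  obtain ⟨X, hX⟩ := exists_forall_abs_sub_le hf hfl hε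
  refine ⟨max 1 (max a (Real.exp X)), le_max_left _ _, fun x hx => hpos x ?_, fun x y hx hxy => ?_⟩
  · exact (le_max_left a _).trans ((le_max_right _ _).trans hx)
  have hx1 : 1 ≤ x := (le_max_left _ _).trans hx
  have hxa : a ≤ x := (le_max_left a _).trans ((le_max_right _ _).trans hx)
  have hxX : Real.exp X ≤ x := (le_max_right a _).trans ((le_max_right _ _).trans hx)
  have hx0 : 0 < x := by linarith
  have hy0 : 0 < y := by linarith
  have := hX (Real.log x) (Real.log y) ((Real.le_log_iff_exp_le hx0).2 hxX)
    (Real.log_le_log hx0 hxy)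
  simp only [hfdef, Real.exp_log hx0, Real.exp_log hy0, hLL x hxa, hLL y (hxa.trans hxy)] at this
  rwa [Real.log_div (hpos y (hxa.trans hxy)).ne' (hpos x hxa).ne', Real.log_div hy0.ne' hx0.ne']

/-! ### Regularly varying sequences -/

/-- A sequence is regularly varying of index `-D` if it is eventually positive and satisfies
Potter's bounds `r k / r n ≈ (n / k) ^ D` with arbitrarily small error in the exponent. -/
def RegularlyVarying (r : ℕ → ℝ) (D : ℝ) : Prop :=
  ∀ ε > 0, ∃ N : ℕ, 1 ≤ N ∧ (∀ k, N ≤ k → 0 < r k) ∧ ∀ k n : ℕ, N ≤ k → k ≤ n →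
    |Real.log (r k / r n) - D * Real.log (n / k)| ≤ ε * (Real.log (n / k) + 1)

/-- The power cancels exactly: `log (r k / r n) - D log (n / k)` is `log (L k / L n)`, to which
Potter's bound applies. -/
theorem IsSlowlyVarying.regularlyVarying {L : ℝ → ℝ} (hL : IsSlowlyVarying L) {r : ℕ → ℝ} {D : ℝ}
    (hr : ∀ᶠ k : ℕ in atTop, r k = L k * (k : ℝ) ^ (-D)) : RegularlyVarying r D := by
  intro ε hε
  obtain ⟨N, hN1, hpos, hN⟩ := hL.exists_abs_log_div_le hε
  obtain ⟨K, hK⟩ := eventually_atTop.1 hr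
  have hcast : ∀ k : ℕ, max K ⌈N⌉₊ ≤ k → N ≤ k := fun k hk =>
    (Nat.le_ceil N).trans (by exact_mod_cast (le_max_right _ _).trans hk)
  refine ⟨max K ⌈N⌉₊, ?_, fun k hk => ?_, fun k n hk hkn => ?_⟩
  · exact le_max_of_le_right (Nat.one_le_ceil_iff.2 (by linarith))
  · have h1 := hcast k hk
    rw [hK k ((le_max_left _ _).trans hk)]
    exact mul_pos (hpos _ h1) (Real.rpow_pos_of_pos (by linarith) _)
  · have h1 := hcast k hk
    have h2 := hcast n (hk.trans hkn)
    have hk0 : (0 : ℝ) < k := by linarith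
    have hn0 : (0 : ℝ) < n := by linarith
    have h3 := hN k n h1 (by exact_mod_cast hkn)
    rw [hK k ((le_max_left _ _).trans hk), hK n ((le_max_left _ _).trans (hk.trans hkn))]
    rw [Real.log_div (mul_pos (hpos _ h1) (Real.rpow_pos_of_pos hk0 _)).ne'
      (mul_pos (hpos _ h2) (Real.rpow_pos_of_pos hn0 _)).ne',
      Real.log_mul (hpos _ h1).ne' (Real.rpow_pos_of_pos hk0 _).ne',
      Real.log_mul (hpos _ h2).ne' (Real.rpow_pos_of_pos hn0 _).ne',
      Real.log_rpow hk0, Real.log_rpow hn0, Real.log_div hn0.ne' hk0.ne']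
    rw [Real.log_div (hpos _ h2).ne' (hpos _ h1).ne', Real.log_div hn0.ne' hk0.ne', abs_sub_comm]
      at h3
    convert h3 using 2
    ring

namespace RegularlyVarying

variable {r : ℕ → ℝ} {D : ℝ}

theorem eventually_pos (hr : RegularlyVarying r D) : ∀ᶠ k in atTop, 0 < r k := by
  obtain ⟨N, -, h, -⟩ := hr 1 one_pos
  exact eventually_atTop.2 ⟨N, h⟩

theorem abs (hr : RegularlyVarying r D) : RegularlyVarying (fun k => |r k|) D := by
  intro ε hε
  obtain ⟨N, hN1, hpos, hN⟩ := hr ε hε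
  refine ⟨N, hN1, fun k hk => abs_pos.2 (hpos k hk).ne', fun k n hk hkn => ?_⟩
  beta_reduce
  rw [abs_of_pos (hpos k hk), abs_of_pos (hpos n (hk.trans hkn))]
  exact hN k n hk hkn

/-- Potter's bounds. -/
theorem exists_bounds (hr : RegularlyVarying r D) {ε : ℝ} (hε : 0 < ε) :
    ∃ N : ℕ, 1 ≤ N ∧ (∀ k, N ≤ k → 0 < r k) ∧ ∀ k n : ℕ, N ≤ k → k ≤ n →
      r k / r n ≤ Real.exp ε * ((n : ℝ) / k) ^ (D + ε) ∧
      Real.exp (-ε) * ((n : ℝ) / k) ^ (D - ε) ≤ r k / r n := by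
  obtain ⟨N, hN1, hpos, hN⟩ := hr ε hε
  refine ⟨N, hN1, hpos, fun k n hk hkn => ?_⟩
  have hk0 : (0 : ℝ) < k := by exact_mod_cast hN1.trans hk
  have hn0 : (0 : ℝ) < n := by exact_mod_cast hN1.trans (hk.trans hkn)
  have h := abs_le.1 (hN k n hk hkn)
  have hq : 0 < r k / r n := div_pos (hpos k hk) (hpos n (hk.trans hkn))
  rw [Real.rpow_def_of_pos (by positivity), Real.rpow_def_of_pos (by positivity),
    ← Real.exp_add, ← Real.exp_add, ← Real.log_le_iff_le_exp hq, ← Real.le_log_iff_exp_le hq]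
  constructor <;> nlinarith [h.1, h.2]

/-- Since `log (b n / a n)` stays bounded, Potter's error `ε (log (b n / a n) + 1)` can be made
arbitrarily small. -/
theorem tendsto_div (hr : RegularlyVarying r D) {a b : ℕ → ℕ} (ha : Tendsto a atTop atTop)
    (hab : ∀ᶠ n in atTop, a n ≤ b n) {c : ℝ} (hc : 0 < c)
    (h : Tendsto (fun n => (b n : ℝ) / a n) atTop (𝓝 c)) :
    Tendsto (fun n => r (a n) / r (b n)) atTop (𝓝 (c ^ D)) := by
  have hlog : Tendsto (fun n => Real.log ((b n : ℝ) / a n)) atTop (𝓝 (Real.log c)) :=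
    (Real.continuousAt_log hc.ne').tendsto.comp h
  have hb : ∀ᶠ n in atTop, Real.log ((b n : ℝ) / a n) + 1 ≤ |Real.log c| + 2 := by
    filter_upwards [hlog.eventually_lt_const (lt_add_one _)] with n hn
    linarith [le_abs_self (Real.log c)]
  have h0 : Tendsto (fun n => Real.log (r (a n) / r (b n)) - D * Real.log ((b n : ℝ) / a n)) atTop
      (𝓝 0) := by
    rw [Metric.tendsto_nhds]
    intro ε hε
    have hC : 0 < |Real.log c| + 2 := by positivity
    obtain ⟨N, -, -, hN⟩ := hr (ε / 2 / (|Real.log c| + 2)) (by positivity)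
    filter_upwards [hb, hab, ha.eventually_ge_atTop N] with n h1 h2 h3
    rw [Real.dist_eq, sub_zero]
    calc _ ≤ ε / 2 / (|Real.log c| + 2) * (Real.log ((b n : ℝ) / a n) + 1) := hN _ _ h3 h2
      _ ≤ ε / 2 / (|Real.log c| + 2) * (|Real.log c| + 2) := by gcongr
      _ = ε / 2 := by field_simp
      _ < ε := by linarith
  have h1 := h0.add (hlog.const_mul D)
  simp only [sub_add_cancel, zero_add] at h1
  have h2 := (Real.continuous_exp.tendsto _).comp h1
  rw [mul_comm, ← Real.rpow_def_of_pos hc] at h2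
  refine h2.congr' ?_
  obtain ⟨N, -, hpos, -⟩ := hr 1 one_pos
  filter_upwards [hab, ha.eventually_ge_atTop N] with n h2 h3
  exact Real.exp_log (div_pos (hpos _ h3) (hpos _ (h3.trans h2)))

/-- Potter's bound with `ε = D / 2` gives decay at least like `n ^ (-D / 2)`. -/
theorem tendsto_zero (hr : RegularlyVarying r D) (hD : 0 < D) : Tendsto r atTop (𝓝 0) := by
  obtain ⟨N, hN1, hpos, hN⟩ := hr.exists_bounds (half_pos hD)
  have hN0 : (0 : ℝ) < N := by exact_mod_cast hN1
  have h1 : Tendsto (fun n : ℕ => r N * Real.exp (D / 2) * ((n : ℝ) / N) ^ (-(D / 2))) atTop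
      (𝓝 (r N * Real.exp (D / 2) * 0)) :=
    ((tendsto_rpow_neg_atTop (half_pos hD)).comp
      (tendsto_natCast_atTop_atTop.atTop_div_const hN0)).const_mul _
  rw [mul_zero] at h1
  refine tendsto_of_tendsto_of_tendsto_of_le_of_le' tendsto_const_nhds h1
    (hr.eventually_pos.mono fun _ h => h.le) ?_
  filter_upwards [eventually_ge_atTop N] with n hn
  have h2 := (hN N n le_rfl hn).2
  have hn0 : (0 : ℝ) < n := by exact_mod_cast hN1.trans hn
  rw [le_div_iff₀ (hpos n hn), show D - D / 2 = D / 2 by ring] at h2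
  have hx : 0 < ((n : ℝ) / N) ^ (D / 2) := by positivity
  rw [Real.rpow_neg (by positivity), ← div_eq_mul_inv, le_div_iff₀ hx]
  have he : Real.exp (D / 2) * Real.exp (-(D / 2)) = 1 := by rw [← Real.exp_add]; simp
  calc r n * ((n : ℝ) / N) ^ (D / 2)
      = Real.exp (D / 2) * (Real.exp (-(D / 2)) * ((n : ℝ) / N) ^ (D / 2) * r n) := by
        linear_combination (-(r n * ((n : ℝ) / N) ^ (D / 2))) * he
    _ ≤ Real.exp (D / 2) * r N := by gcongr
    _ = _ := mul_comm _ _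

/-- With `ε = (1 - D) / 2` one has `D + ε = 1 - ε`, so `n * r n` grows at least like `n ^ ε`. -/
theorem tendsto_mul_atTop (hr : RegularlyVarying r D) (hD : D < 1) :
    Tendsto (fun n : ℕ => (n : ℝ) * r n) atTop atTop := by
  set ε := (1 - D) / 2 with hε
  have hε0 : 0 < ε := by rw [hε]; linarith
  obtain ⟨N, hN1, hpos, hN⟩ := hr.exists_bounds hε0
  have hN0 : (0 : ℝ) < N := by exact_mod_cast hN1
  have h1 : Tendsto (fun n : ℕ => (r N * Real.exp (-ε) * N) * ((n : ℝ) / N) ^ ε) atTop atTop :=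
    ((tendsto_rpow_atTop hε0).comp
      (tendsto_natCast_atTop_atTop.atTop_div_const hN0)).const_mul_atTop
      (mul_pos (mul_pos (hpos N le_rfl) (Real.exp_pos _)) hN0)
  refine tendsto_atTop_mono' _ ?_ h1
  filter_upwards [eventually_ge_atTop N] with n hn
  have h2 := (hN N n le_rfl hn).1
  have hn0 : (0 : ℝ) < n := by exact_mod_cast hN1.trans hn
  rw [div_le_iff₀ (hpos n hn), show D + ε = 1 - ε by rw [hε]; ring] at h2
  have hx : 0 < (n : ℝ) / N := by positivity
  have h3 : ((n : ℝ) / N) ^ (1 - ε) * ((n : ℝ) / N) ^ ε = n / N := by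
    rw [← Real.rpow_add hx]; simp
  have he : Real.exp ε * Real.exp (-ε) = 1 := by rw [← Real.exp_add]; simp
  calc (r N * Real.exp (-ε) * N) * ((n : ℝ) / N) ^ ε
      ≤ (Real.exp ε * ((n : ℝ) / N) ^ (1 - ε) * r n) * Real.exp (-ε) * N * ((n : ℝ) / N) ^ ε := by
        gcongr
    _ = (Real.exp ε * Real.exp (-ε)) * (((n : ℝ) / N) ^ (1 - ε) * ((n : ℝ) / N) ^ ε) * N * r n := by
        ring
    _ = n * r n := by rw [he, h3]; field_simp

end RegularlyVarying

/-! ### Riemann sums and Karamata's theorem -/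

/-- Writing a Riemann sum as the integral of a step function makes dominated convergence available.
-/
theorem integral_comp_floor_mul (f : ℕ → ℝ) {n : ℕ} (hn : n ≠ 0) :
    ∫ x in (0 : ℝ)..1, f ⌊(n : ℝ) * x⌋₊ = (1 / n : ℝ) * ∑ k ∈ Finset.range n, f k := by
  have hn0 : (n : ℝ) ≠ 0 := by exact_mod_cast hn
  rw [intervalIntegral.integral_comp_mul_left (fun x => f ⌊x⌋₊) hn0]
  simp only [mul_zero, mul_one, smul_eq_mul, one_div]
  congr 1
  have h1 : ∀ k : ℕ, Set.EqOn (fun x : ℝ => f ⌊x⌋₊) (fun _ => f k) (Set.Ico k ((k + 1 : ℕ) : ℝ)) := by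
    intro k x hx
    have : ⌊x⌋₊ = k := (Nat.floor_eq_iff ((Nat.cast_nonneg k).trans hx.1)).2
      ⟨hx.1, by exact_mod_cast hx.2⟩
    simp [this]
  have h2 : ∀ k : ℕ, ∀ᵐ x, x ∈ Set.uIoc (k : ℝ) ((k + 1 : ℕ) : ℝ) → f ⌊x⌋₊ = f k := by
    intro k
    have : ∀ᵐ x : ℝ, x ≠ ((k + 1 : ℕ) : ℝ) := by simp [ae_iff]
    filter_upwards [this] with x hx hx2
    rw [Set.uIoc_of_le (by simp)] at hx2
    exact h1 k ⟨hx2.1.le, lt_of_le_of_ne hx2.2 hx⟩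
  have := intervalIntegral.sum_integral_adjacent_intervals (f := fun x : ℝ => f ⌊x⌋₊)
    (μ := volume) (a := fun k : ℕ => (k : ℝ)) (n := n) (fun k _ =>
      (intervalIntegrable_const (c := f k)).congr_ae
        ((ae_restrict_iff' measurableSet_uIoc).2 ((h2 k).mono fun x hx h => (hx h).symm)))
  simp only [Nat.cast_zero] at this
  rw [← this]
  refine Finset.sum_congr rfl fun k _ => ?_
  rw [intervalIntegral.integral_congr_ae (h2 k)]
  simp

theorem tendsto_floor_mul_div {x : ℝ} (hx : 0 < x) :
    Tendsto (fun n : ℕ => (⌊(n : ℝ) * x⌋₊ : ℝ) / n) atTop (𝓝 x) := by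
  have := (tendsto_nat_floor_mul_div_atTop hx.le).comp (tendsto_natCast_atTop_atTop (R := ℝ))
  refine this.congr fun n => ?_
  simp [mul_comm]

/-- Karamata's theorem for weighted sums of a regularly varying sequence. -/
theorem RegularlyVarying.tendsto_weighted_sum {r : ℕ → ℝ} {D : ℝ} (hr : RegularlyVarying r D)
    (hD0 : 0 < D) (hD1 : D < 1)
    {w : ℝ → ℝ} (hw : Continuous w) (hw1 : ∀ x ∈ Set.Icc (0 : ℝ) 1, |w x| ≤ 1) :
    Tendsto (fun n : ℕ => (1 / n : ℝ) * ∑ k ∈ Finset.range n, w (k / n) * (r k / r n)) atTop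
      (𝓝 (∫ x in (0 : ℝ)..1, w x * x ^ (-D))) := by
  set ε := (1 - D) / 2 with hε
  have hε0 : 0 < ε := by rw [hε]; linarith
  obtain ⟨N, hN1, hpos, hN⟩ := hr.exists_bounds hε0
  -- The indices below `N`, where Potter's bounds may fail, are cut off and treated separately in
  -- `hrest`.
  set φ : ℕ → ℕ → ℝ := fun n k => if k < N then 0 else w (k / n) * (r k / r n) with hφ
  have hmain : Tendsto (fun n : ℕ => ∫ x in (0 : ℝ)..1, φ n ⌊(n : ℝ) * x⌋₊) atTop
      (𝓝 (∫ x in (0 : ℝ)..1, w x * x ^ (-D))) := by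
    refine intervalIntegral.tendsto_integral_filter_of_dominated_convergence
      -- Potter's bound at `k = ⌊n x⌋ ≥ 1`, where `n x < k + 1 ≤ 2 k` gives `n / k ≤ 2 / x`. The
      -- majorant is integrable at 0 because `D + ε < 1`.
      (fun x => Real.exp ε * 2 ^ (D + ε) * x ^ (-(D + ε))) ?_ ?_ ?_ ?_
    · refine Eventually.of_forall fun n => Measurable.aestronglyMeasurable ?_
      exact (measurable_from_nat (f := φ n)).comp (Nat.measurable_floor.comp (by fun_prop))
    · filter_upwards [eventually_ge_atTop N] with n hn
      have hn0 : (0 : ℝ) < n := by exact_mod_cast hN1.trans hn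
      refine Eventually.of_forall fun x hx => ?_
      rw [Set.uIoc_of_le zero_le_one] at hx
      have hx0 : 0 < x := hx.1
      have hb : 0 ≤ Real.exp ε * 2 ^ (D + ε) * x ^ (-(D + ε)) := by positivity
      simp only [hφ]
      split_ifs with hk
      · simpa using hb
      push Not at hk
      set k := ⌊(n : ℝ) * x⌋₊
      have hkn' : (k : ℝ) ≤ n * x := Nat.floor_le (by positivity)
      have hkn : k ≤ n := by
        have : (k : ℝ) ≤ n := hkn'.trans (mul_le_of_le_one_right hn0.le hx.2)
        exact_mod_cast this
      have hk1 : (1 : ℝ) ≤ k := by exact_mod_cast hN1.trans hk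
      have hlt : n * x < k + 1 := Nat.lt_floor_add_one _
      have hq : 0 < r k / r n := div_pos (hpos k hk) (hpos n hn)
      have hwk : |w (k / n)| ≤ 1 := hw1 _ ⟨by positivity, by
        rw [div_le_one hn0]; exact_mod_cast hkn⟩
      have hnk : (n : ℝ) / k ≤ 2 / x := by
        rw [div_le_div_iff₀ (by linarith) hx0]; linarith
      rw [Real.norm_eq_abs, abs_mul, abs_of_pos hq]
      calc |w (k / n)| * (r k / r n) ≤ 1 * (r k / r n) := by gcongr
        _ ≤ Real.exp ε * ((n : ℝ) / k) ^ (D + ε) := by rw [one_mul]; exact (hN k n hk hkn).1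
        _ ≤ Real.exp ε * (2 / x) ^ (D + ε) := by gcongr
        _ = _ := by
          rw [Real.div_rpow (by norm_num) hx0.le, Real.rpow_neg hx0.le]
          ring
    · refine (intervalIntegral.intervalIntegrable_rpow' ?_).const_mul _
      rw [hε]; linarith
    · have h1 : ∀ᵐ x : ℝ, x ≠ 1 := by simp [ae_iff]
      filter_upwards [h1] with x hx1 hx
      rw [Set.uIoc_of_le zero_le_one] at hx
      have hx0 : 0 < x := hx.1
      have hfl : Tendsto (fun n : ℕ => ⌊(n : ℝ) * x⌋₊) atTop atTop :=
        tendsto_nat_floor_atTop.comp (tendsto_natCast_atTop_atTop.atTop_mul_const hx0)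
      have hd := tendsto_floor_mul_div hx0
      have hrr := hr.tendsto_div (a := fun n => ⌊(n : ℝ) * x⌋₊) (b := fun n => n) hfl
        (Eventually.of_forall fun n => by
          have : (⌊(n : ℝ) * x⌋₊ : ℝ) ≤ n := (Nat.floor_le (by positivity)).trans
            (mul_le_of_le_one_right (Nat.cast_nonneg n) hx.2)
          exact_mod_cast this) (inv_pos.2 hx0)
        ((hd.inv₀ hx0.ne').congr fun n => by simp)
      rw [Real.inv_rpow hx0.le, ← Real.rpow_neg hx0.le] at hrr
      refine (((hw.tendsto x).comp hd).mul hrr).congr' ?_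
      filter_upwards [hfl.eventually_ge_atTop N] with n hn
      simp only [hφ, if_neg (not_lt.2 hn), Function.comp]
  have hrest : Tendsto (fun n : ℕ => (1 / n : ℝ) * ∑ k ∈ Finset.range n,
      (w (k / n) * (r k / r n) - φ n k)) atTop (𝓝 0) := by
    -- The discarded terms are finitely many, so they contribute at most `B / (n * r n)`, which
    -- vanishes.
    set B := ∑ k ∈ Finset.range N, |r k|
    have hB : Tendsto (fun n : ℕ => B / ((n : ℝ) * r n)) atTop (𝓝 0) :=
      (hr.tendsto_mul_atTop hD1).const_div_atTop B
    refine squeeze_zero_norm' ?_ hB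
    filter_upwards [eventually_ge_atTop N] with n hn
    have hn0 : (0 : ℝ) < n := by exact_mod_cast hN1.trans hn
    have hrn := hpos n hn
    rw [← Finset.sum_subset (Finset.range_subset_range.2 hn)]
    · rw [norm_mul, Real.norm_of_nonneg (by positivity : (0 : ℝ) ≤ 1 / n)]
      calc (1 / n : ℝ) * ‖∑ k ∈ Finset.range N, (w (k / n) * (r k / r n) - φ n k)‖
          ≤ (1 / n : ℝ) * ∑ k ∈ Finset.range N, |r k| / r n := by
            gcongr
            refine norm_sum_le_of_le _ fun k hk => ?_
            have hkN := Finset.mem_range.1 hk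
            simp only [hφ, if_pos hkN, sub_zero]
            rw [Real.norm_eq_abs, abs_mul, abs_div, abs_of_pos hrn]
            refine mul_le_of_le_one_left (by positivity) (hw1 _ ⟨by positivity, ?_⟩)
            rw [div_le_one hn0]; exact_mod_cast (hkN.le.trans hn)
        _ = B / (n * r n) := by rw [← Finset.sum_div]; field_simp; rfl
    · intro k _ hk
      simp only [hφ, if_neg (fun h => hk (Finset.mem_range.2 h)), sub_self]
  have := hmain.add hrest
  rw [add_zero] at this
  refine this.congr' ?_
  filter_upwards [eventually_ne_atTop 0] with n hn
  rw [integral_comp_floor_mul _ hn, ← mul_add, ← Finset.sum_add_distrib]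
  simp

/-! ### Double sums of autocovariances -/

/-- A lag `k ≥ 1` occurs `2 (n - k)` times and lag 0 only `n` times; the last term corrects the
double count at lag 0. -/
theorem sum_sum_natAbs_sub (r : ℕ → ℝ) (n : ℕ) :
    ∑ i ∈ Finset.range n, ∑ j ∈ Finset.range n, r ((i : ℤ) - j).natAbs =
      2 * ∑ k ∈ Finset.range n, ((n : ℝ) - k) * r k - n * r 0 := by
  induction n with
  | zero => simp
  | succ n ih =>
    have h1 : ∀ i ∈ Finset.range n, r ((i : ℤ) - n).natAbs = r (n - i) := fun i hi => by
      have := Finset.mem_range.1 hi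
      congr 1; omega
    have h2 : ∀ i ∈ Finset.range n, r ((n : ℤ) - i).natAbs = r (n - i) := fun i hi => by
      have := Finset.mem_range.1 hi
      congr 1; omega
    have h3 : ∑ i ∈ Finset.range n, r (n - i) = ∑ k ∈ Finset.range n, r (k + 1) := by
      rw [← Finset.sum_range_reflect]
      refine Finset.sum_congr rfl fun i hi => ?_
      have := Finset.mem_range.1 hi
      congr 1; omega
    have h4 : ∑ k ∈ Finset.range n, r (k + 1) = ∑ k ∈ Finset.range n, r k + r n - r 0 := by
      rw [← Finset.sum_range_succ, Finset.sum_range_succ']; ring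
    have h5 : ∑ k ∈ Finset.range n, (((n + 1 : ℕ) : ℝ) - k) * r k =
        ∑ k ∈ Finset.range n, ((n : ℝ) - k) * r k + ∑ k ∈ Finset.range n, r k := by
      rw [← Finset.sum_add_distrib]
      refine Finset.sum_congr rfl fun k _ => ?_
      push_cast; ring
    rw [Finset.sum_range_succ, Finset.sum_range_succ]
    simp_rw [Finset.sum_range_succ _ n]
    rw [Finset.sum_add_distrib, ih, Finset.sum_congr rfl h1, Finset.sum_congr rfl h2, h3, h4, h5]
    simp only [sub_self, Int.natAbs_zero]
    push_cast
    ring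

theorem abs_sum_sum_natAbs_sub_le (r : ℕ → ℝ) (n : ℕ) :
    |∑ i ∈ Finset.range n, ∑ j ∈ Finset.range n, r ((i : ℤ) - j).natAbs| ≤
      2 * n * ∑ k ∈ Finset.range n, |r k| := by
  calc _ ≤ ∑ i ∈ Finset.range n, ∑ j ∈ Finset.range n, |r ((i : ℤ) - j).natAbs| :=
        (Finset.abs_sum_le_sum_abs _ _).trans
          (Finset.sum_le_sum fun i _ => Finset.abs_sum_le_sum_abs _ _)
    _ = 2 * ∑ k ∈ Finset.range n, ((n : ℝ) - k) * |r k| - n * |r 0| :=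
        sum_sum_natAbs_sub (fun k => |r k|) n
    _ ≤ 2 * ∑ k ∈ Finset.range n, (n : ℝ) * |r k| - 0 := by
        gcongr with k _
        · have : (0 : ℝ) ≤ k := k.cast_nonneg
          linarith
        · positivity
    _ = _ := by rw [← Finset.mul_sum]; ring

theorem integral_one_sub_mul_rpow {D : ℝ} (hD1 : D < 1) :
    ∫ x in (0 : ℝ)..1, (1 - x) * x ^ (-D) = 1 / ((1 - D) * (2 - D)) := by
  have h : ∀ᵐ x, x ∈ Set.uIoc (0 : ℝ) 1 → (1 - x) * x ^ (-D) = x ^ (-D) - x ^ (1 - D) := by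
    refine Eventually.of_forall fun x hx => ?_
    rw [Set.uIoc_of_le zero_le_one] at hx
    rw [sub_mul, one_mul, sub_eq_add_neg 1 D, Real.rpow_add hx.1, Real.rpow_one]
  rw [intervalIntegral.integral_congr_ae h, intervalIntegral.integral_sub
    (intervalIntegral.intervalIntegrable_rpow' (by linarith))
    (intervalIntegral.intervalIntegrable_rpow' (by linarith)),
    integral_rpow (Or.inl (by linarith)), integral_rpow (Or.inl (by linarith))]
  have h1 : (1 - D) ≠ 0 := by linarith
  have h2 : (2 - D) ≠ 0 := by linarith
  rw [show -D + 1 = 1 - D by ring, show 1 - D + 1 = 2 - D by ring, Real.one_rpow, Real.one_rpow,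
    Real.zero_rpow h1, Real.zero_rpow h2]
  field_simp
  ring

namespace RegularlyVarying

variable {r : ℕ → ℝ} {D : ℝ}

/-- The variance of partial sums of a stationary sequence with autocovariance `r` is
asymptotic to `2 / ((1 - D) (2 - D)) n ^ 2 r n`. -/
theorem tendsto_sum_sum_div (hr : RegularlyVarying r D) (hD0 : 0 < D) (hD1 : D < 1) :
    Tendsto (fun n : ℕ => (∑ i ∈ Finset.range n, ∑ j ∈ Finset.range n, r ((i : ℤ) - j).natAbs) /
      ((n : ℝ) ^ 2 * r n)) atTop (𝓝 (2 / ((1 - D) * (2 - D)))) := by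
  have h1 := hr.tendsto_weighted_sum hD0 hD1 (w := fun x => 1 - x) (by fun_prop)
    (fun x hx => by rw [abs_of_nonneg (by linarith [hx.2])]; linarith [hx.1])
  rw [integral_one_sub_mul_rpow hD1] at h1
  have h2 : Tendsto (fun n : ℕ => r 0 / ((n : ℝ) * r n)) atTop (𝓝 0) :=
    (hr.tendsto_mul_atTop hD1).const_div_atTop _
  have h3 := (h1.const_mul 2).sub h2
  rw [sub_zero, mul_one_div] at h3
  refine h3.congr' ?_
  filter_upwards [eventually_gt_atTop 0, hr.eventually_pos] with n hn hrn
  have hn0 : (0 : ℝ) < n := by exact_mod_cast hn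
  rw [sum_sum_natAbs_sub, sub_div]
  congr 1
  · rw [mul_div_assoc, Finset.sum_div, Finset.mul_sum]
    congr 1
    refine Finset.sum_congr rfl fun k _ => ?_
    field_simp
  · field_simp

theorem tendsto_sum_abs_div (hr : RegularlyVarying r D) (hD0 : 0 < D) (hD1 : D < 1) :
    Tendsto (fun n : ℕ => (∑ k ∈ Finset.range n, |r k|) / ((n : ℝ) * r n)) atTop
      (𝓝 (1 / (1 - D))) := by
  have h1 := hr.abs.tendsto_weighted_sum hD0 hD1 (w := fun _ => 1) continuous_const (by simp)
  have h2 : ∫ x in (0 : ℝ)..1, 1 * x ^ (-D) = 1 / (1 - D) := by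
    simp only [one_mul]
    rw [integral_rpow (Or.inl (by linarith)), show -D + 1 = 1 - D by ring, Real.one_rpow,
      Real.zero_rpow (by linarith), sub_zero]
  rw [h2] at h1
  refine h1.congr' ?_
  filter_upwards [hr.eventually_pos] with n hrn
  simp only [one_mul]
  rw [← Finset.sum_div, abs_of_pos hrn]
  field_simp

/-- The double sum is at most `2 n ∑ |ψ k|`. As `∑ |r k|` diverges, the little-o relation passes to
partial sums, and `∑ |r k|` is of order `n * r n`. -/
theorem tendsto_sum_sum_div_of_isLittleO (hr : RegularlyVarying r D) (hD0 : 0 < D) (hD1 : D < 1)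
    {ψ : ℕ → ℝ} (hψ : ψ =o[atTop] r) :
    Tendsto (fun n : ℕ => (∑ i ∈ Finset.range n, ∑ j ∈ Finset.range n, ψ ((i : ℤ) - j).natAbs) /
      ((n : ℝ) ^ 2 * r n)) atTop (𝓝 0) := by
  have hlim := hr.tendsto_sum_abs_div hD0 hD1
  have hinf := hr.tendsto_mul_atTop hD1
  have hsum : Tendsto (fun n => ∑ k ∈ Finset.range n, |r k|) atTop atTop := by
    refine (hlim.pos_mul_atTop (by rw [one_div_pos]; linarith) hinf).congr' ?_
    filter_upwards [eventually_gt_atTop 0, hr.eventually_pos] with n hn hrn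
    have hn0 : (0 : ℝ) < n := by exact_mod_cast hn
    field_simp
  have h1 := (hψ.abs_abs.sum_range (fun k => abs_nonneg _) hsum).tendsto_div_nhds_zero
  have h2 := (h1.mul hlim).const_mul 2
  rw [zero_mul, mul_zero] at h2
  refine squeeze_zero_norm' ?_ h2
  filter_upwards [eventually_gt_atTop 0, hr.eventually_pos, hsum.eventually_gt_atTop 0]
    with n hn hrn hs
  have hn0 : (0 : ℝ) < n := by exact_mod_cast hn
  rw [norm_div, Real.norm_eq_abs, Real.norm_of_nonneg (by positivity : 0 ≤ (n : ℝ) ^ 2 * r n)]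
  calc _ ≤ (2 * n * ∑ k ∈ Finset.range n, |ψ k|) / ((n : ℝ) ^ 2 * r n) := by
        gcongr
        exact abs_sum_sum_natAbs_sub_le ψ n
    _ = _ := by field_simp

end RegularlyVarying

/-! ### The Mehler kernel -/

/-- Cauchy-Schwarz, from the discriminant of `t ↦ ∫ (t f + g)²`. -/
theorem sq_integral_mul_le {α : Type*} [MeasurableSpace α] {μ : Measure α} {f g : α → ℝ}
    (hf : MemLp f 2 μ) (hg : MemLp g 2 μ) :
    (∫ x, f x * g x ∂μ) ^ 2 ≤ (∫ x, f x ^ 2 ∂μ) * ∫ x, g x ^ 2 ∂μ := by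
  have hfg : Integrable (fun x => f x * g x) μ := hf.integrable_mul hg
  have hquad : ∀ t : ℝ, 0 ≤ (∫ x, f x ^ 2 ∂μ) * (t * t) + (2 * ∫ x, f x * g x ∂μ) * t +
      ∫ x, g x ^ 2 ∂μ := by
    intro t
    have h : ∫ x, (t * f x + g x) ^ 2 ∂μ = (∫ x, f x ^ 2 ∂μ) * (t * t) +
        (2 * ∫ x, f x * g x ∂μ) * t + ∫ x, g x ^ 2 ∂μ := by
      have : (fun x => (t * f x + g x) ^ 2) =
          fun x => f x ^ 2 * (t * t) + f x * g x * (2 * t) + g x ^ 2 := by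
        ext x; ring
      rw [this, integral_add, integral_add, integral_mul_const, integral_mul_const]
      · ring
      · exact hf.integrable_sq.mul_const _
      · exact hfg.mul_const _
      · exact (hf.integrable_sq.mul_const _).add (hfg.mul_const _)
      · exact hg.integrable_sq
    rw [← h]
    exact integral_nonneg fun x => sq_nonneg _
  have := discrim_le_zero hquad
  rw [discrim] at this
  linarith

theorem pi_withDensity {ι : Type*} [Fintype ι] {E : ι → Type*} [∀ i, MeasurableSpace (E i)]
    (μ : (i : ι) → Measure (E i)) [∀ i, IsProbabilityMeasure (μ i)]
    (f : (i : ι) → E i → ENNReal) (hf : ∀ i, Measurable (f i))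
    [∀ i, SigmaFinite ((μ i).withDensity (f i))] :
    Measure.pi (fun i => (μ i).withDensity (f i)) =
      (Measure.pi μ).withDensity fun x => ∏ i, f i (x i) := by
  refine Measure.pi_eq fun s hs => ?_
  have hm : ∀ i, Measurable ((s i).indicator (f i)) := fun i => (hf i).indicator (hs i)
  rw [withDensity_apply _ (.univ_pi hs), ← lintegral_indicator (.univ_pi hs)]
  have h1 : (Set.univ.pi s).indicator (fun x => ∏ i, f i (x i)) =
      fun x => ∏ i, (s i).indicator (f i) (x i) := by
    ext x
    by_cases hx : x ∈ Set.univ.pi s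
    · rw [Set.indicator_of_mem hx]
      exact Finset.prod_congr rfl fun i _ => (Set.indicator_of_mem (hx i (Set.mem_univ i)) _).symm
    · rw [Set.indicator_of_notMem hx]
      simp only [Set.mem_pi, Set.mem_univ, true_implies, not_forall] at hx
      obtain ⟨i, hi⟩ := hx
      exact (Finset.prod_eq_zero (Finset.mem_univ i) (Set.indicator_of_notMem hi _)).symm
  rw [h1, lintegral_prod_eq_prod_lintegral_of_indepFun Finset.univ
    (fun i (x : (i : ι) → E i) => (s i).indicator (f i) (x i))
    (iIndepFun_pi fun i => (hm i).aemeasurable) (fun i => (hm i).comp (measurable_pi_apply i))]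
  refine Finset.prod_congr rfl fun i _ => ?_
  rw [withDensity_apply _ (hs i), ← lintegral_indicator (hs i)]
  exact (measurePreserving_eval μ i).lintegral_comp (hm i)

/-- The density of `N(s x, 1 - s²)` with respect to `N(0, 1)`. -/
noncomputable def mehler (s x y : ℝ) : ℝ :=
  gaussianPDFReal (s * x) (1 - s ^ 2).toNNReal y / gaussianPDFReal 0 1 y

/-- The second moment of `mehler s x` under `N(0, 1)`. -/
noncomputable def mehlerSq (s x : ℝ) : ℝ :=
  (√((1 - s ^ 2) * (1 + s ^ 2)))⁻¹ * Real.exp (s ^ 2 * x ^ 2 / (1 + s ^ 2))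

section

variable {s : ℝ}

theorem one_sub_sq_pos (hs : s ∈ Set.Ioo (0 : ℝ) 1) : 0 < 1 - s ^ 2 := by
  nlinarith [hs.1, hs.2]

theorem toNNReal_one_sub_sq_ne_zero (hs : s ∈ Set.Ioo (0 : ℝ) 1) : (1 - s ^ 2).toNNReal ≠ 0 :=
  (Real.toNNReal_pos.2 (one_sub_sq_pos hs)).ne'

theorem mehler_nonneg (s x y : ℝ) : 0 ≤ mehler s x y :=
  div_nonneg (gaussianPDFReal_nonneg _ _ _) (gaussianPDFReal_nonneg _ _ _)

theorem measurable_mehler (s x : ℝ) : Measurable (mehler s x) :=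
  (measurable_gaussianPDFReal _ _).div (measurable_gaussianPDFReal _ _)

theorem gaussianReal_eq_withDensity_mehler (hs : s ∈ Set.Ioo (0 : ℝ) 1) (x : ℝ) :
    gaussianReal (s * x) (1 - s ^ 2).toNNReal =
      (gaussianReal 0 1).withDensity fun y => ENNReal.ofReal (mehler s x y) := by
  rw [gaussianReal_of_var_ne_zero _ (toNNReal_one_sub_sq_ne_zero hs),
    gaussianReal_of_var_ne_zero _ one_ne_zero,
    ← withDensity_mul _ (measurable_gaussianPDF _ _) (measurable_mehler s x).ennreal_ofReal]
  congr 1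
  ext y
  rw [Pi.mul_apply, gaussianPDF, gaussianPDF, ← ENNReal.ofReal_mul (gaussianPDFReal_nonneg _ _ _),
    mehler, mul_div_cancel₀ _ (gaussianPDFReal_pos _ _ _ one_ne_zero).ne']

/-- Completing the square in `y` turns the integrand into a multiple of another Gaussian density, so
that `mehlerSq` can be read off as its total mass. -/
theorem gaussianPDFReal_mul_mehler_sq (hs : s ∈ Set.Ioo (0 : ℝ) 1) (x y : ℝ) :
    gaussianPDFReal 0 1 y * mehler s x y ^ 2 = mehlerSq s x *
      gaussianPDFReal (2 * s * x / (1 + s ^ 2)) ((1 - s ^ 2) / (1 + s ^ 2)).toNNReal y := by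
  have h1 := one_sub_sq_pos hs
  have h2 : 0 < 1 + s ^ 2 := by positivity
  have hp := (gaussianPDFReal_pos 0 1 y one_ne_zero).ne'
  have h3 : gaussianPDFReal 0 1 y * mehler s x y ^ 2 =
      gaussianPDFReal (s * x) (1 - s ^ 2).toNNReal y ^ 2 / gaussianPDFReal 0 1 y := by
    rw [mehler]; field_simp
  rw [h3, mehlerSq, gaussianPDFReal, gaussianPDFReal, gaussianPDFReal, Real.coe_toNNReal _ h1.le,
    Real.coe_toNNReal _ (div_pos h1 h2).le, NNReal.coe_one, div_eq_mul_inv, mul_inv, inv_inv,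
    ← Real.exp_neg, mul_pow, ← Real.exp_nat_mul]
  have hsq : (√(2 * Real.pi * (1 - s ^ 2)))⁻¹ ^ 2 * √(2 * Real.pi * 1) =
      (√((1 - s ^ 2) * (1 + s ^ 2)))⁻¹ * (√(2 * Real.pi * ((1 - s ^ 2) / (1 + s ^ 2))))⁻¹ := by
    rw [inv_pow, Real.sq_sqrt (by positivity), ← mul_inv, ← Real.sqrt_mul (by positivity),
      show (1 - s ^ 2) * (1 + s ^ 2) * (2 * Real.pi * ((1 - s ^ 2) / (1 + s ^ 2))) =
        (1 - s ^ 2) ^ 2 * (2 * Real.pi) by field_simp, Real.sqrt_mul (sq_nonneg (1 - s ^ 2)),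
      Real.sqrt_sq h1.le, mul_one]
    have hpi : √(2 * Real.pi) ≠ 0 := by positivity
    have hpi2 := Real.mul_self_sqrt (show 0 ≤ 2 * Real.pi by positivity)
    field_simp
    linear_combination hpi2
  have hexp : ((2 : ℕ) : ℝ) * (-(y - s * x) ^ 2 / (2 * (1 - s ^ 2))) + -(-(y - 0) ^ 2 / (2 * 1)) =
      s ^ 2 * x ^ 2 / (1 + s ^ 2) +
        -(y - 2 * s * x / (1 + s ^ 2)) ^ 2 / (2 * ((1 - s ^ 2) / (1 + s ^ 2))) := by
    push_cast
    field_simp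
    ring
  calc _ = ((√(2 * Real.pi * (1 - s ^ 2)))⁻¹ ^ 2 * √(2 * Real.pi * 1)) *
        (Real.exp (((2 : ℕ) : ℝ) * (-(y - s * x) ^ 2 / (2 * (1 - s ^ 2)))) *
          Real.exp (-(-(y - 0) ^ 2 / (2 * 1)))) := by ring
    _ = _ := by rw [hsq, ← Real.exp_add, hexp, Real.exp_add]; ring

theorem integral_mehler_sq (hs : s ∈ Set.Ioo (0 : ℝ) 1) (x : ℝ) :
    ∫ y, mehler s x y ^ 2 ∂(gaussianReal 0 1) = mehlerSq s x := by
  rw [integral_gaussianReal_eq_integral_smul one_ne_zero]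
  simp_rw [smul_eq_mul, gaussianPDFReal_mul_mehler_sq hs]
  rw [integral_const_mul, integral_gaussianPDFReal_eq_one, mul_one]
  exact (Real.toNNReal_pos.2 (div_pos (one_sub_sq_pos hs) (by positivity))).ne'

theorem mehlerSq_pos (hs : s ∈ Set.Ioo (0 : ℝ) 1) (x : ℝ) : 0 < mehlerSq s x := by
  have := one_sub_sq_pos hs
  unfold mehlerSq
  positivity

theorem memLp_mehler (hs : s ∈ Set.Ioo (0 : ℝ) 1) (x : ℝ) :
    MemLp (mehler s x) 2 (gaussianReal 0 1) := by
  rw [memLp_two_iff_integrable_sq (measurable_mehler s x).aestronglyMeasurable]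
  -- If the square were not integrable its Bochner integral would be 0, whereas `mehlerSq` is
  -- positive.
  by_contra h
  have := integral_mehler_sq hs x
  rw [integral_undef h] at this
  exact (mehlerSq_pos hs x).ne this

theorem integral_mehlerSq (hs : s ∈ Set.Ioo (0 : ℝ) 1) :
    ∫ x, mehlerSq s x ∂(gaussianReal 0 1) = (1 - s ^ 2)⁻¹ := by
  have h1 := one_sub_sq_pos hs
  have h2 : 0 < 1 + s ^ 2 := by positivity
  have h3 : 0 < (1 + s ^ 2) / (1 - s ^ 2) := by positivity
  have h : ∀ x, gaussianPDFReal 0 1 x * mehlerSq s x = (1 - s ^ 2)⁻¹ *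
      gaussianPDFReal 0 ((1 + s ^ 2) / (1 - s ^ 2)).toNNReal x := by
    intro x
    rw [mehlerSq, gaussianPDFReal, gaussianPDFReal, Real.coe_toNNReal _ h3.le, NNReal.coe_one]
    have hsq : (√(2 * Real.pi * 1))⁻¹ * (√((1 - s ^ 2) * (1 + s ^ 2)))⁻¹ =
        (1 - s ^ 2)⁻¹ * (√(2 * Real.pi * ((1 + s ^ 2) / (1 - s ^ 2))))⁻¹ := by
      rw [← mul_inv, ← mul_inv, ← Real.sqrt_mul (by positivity)]
      congr 1
      rw [← Real.sqrt_sq h1.le, ← Real.sqrt_mul (by positivity), Real.sqrt_sq h1.le]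
      congr 1
      field_simp
    have hexp : -(x - 0) ^ 2 / (2 * 1) + s ^ 2 * x ^ 2 / (1 + s ^ 2) =
        -(x - 0) ^ 2 / (2 * ((1 + s ^ 2) / (1 - s ^ 2))) := by
      field_simp
      ring
    calc _ = ((√(2 * Real.pi * 1))⁻¹ * (√((1 - s ^ 2) * (1 + s ^ 2)))⁻¹) *
          (Real.exp (-(x - 0) ^ 2 / (2 * 1)) * Real.exp (s ^ 2 * x ^ 2 / (1 + s ^ 2))) := by ring
      _ = _ := by rw [hsq, ← Real.exp_add, hexp, mul_assoc]
  rw [integral_gaussianReal_eq_integral_smul one_ne_zero]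
  simp_rw [smul_eq_mul, h]
  rw [integral_const_mul, integral_gaussianPDFReal_eq_one, mul_one]
  exact (Real.toNNReal_pos.2 h3).ne'

theorem integrable_mehlerSq (hs : s ∈ Set.Ioo (0 : ℝ) 1) :
    Integrable (mehlerSq s) (gaussianReal 0 1) := by
  by_contra h
  have := integral_mehlerSq hs
  rw [integral_undef h] at this
  exact (inv_pos.2 (one_sub_sq_pos hs)).ne this

end

/-! ### The Mehler kernel in several variables -/

/-- The standard Gaussian measure on `ι → ℝ`. -/
noncomputable abbrev stdPi (ι : Type*) [Fintype ι] : Measure (ι → ℝ) :=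
  Measure.pi fun _ : ι => gaussianReal 0 1

section

variable {ι : Type*} [Fintype ι] {s : ℝ}

theorem memLp_eval_stdPi (i : ι) : MemLp (fun y : ι → ℝ => y i) 2 (stdPi ι) :=
  (memLp_id_gaussianReal 2).comp_measurePreserving (measurePreserving_eval _ i)

theorem pi_gaussianReal_eq_withDensity (hs : s ∈ Set.Ioo (0 : ℝ) 1) (x : ι → ℝ) :
    Measure.pi (fun i => gaussianReal (s * x i) (1 - s ^ 2).toNNReal) =
      (stdPi ι).withDensity fun y => ENNReal.ofReal (∏ i, mehler s (x i) (y i)) := by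
  have : ∀ i, SigmaFinite ((gaussianReal 0 1).withDensity
      fun y => ENNReal.ofReal (mehler s (x i) y)) := fun i => by
    rw [← gaussianReal_eq_withDensity_mehler hs]; infer_instance
  simp_rw [gaussianReal_eq_withDensity_mehler hs]
  rw [pi_withDensity _ _ fun i => (measurable_mehler s (x i)).ennreal_ofReal]
  congr 1
  ext y
  rw [ENNReal.ofReal_prod_of_nonneg fun i _ => mehler_nonneg _ _ _]

theorem integral_mul_prod_mehler (hs : s ∈ Set.Ioo (0 : ℝ) 1) (x : ι → ℝ) (g : (ι → ℝ) → ℝ) :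
    ∫ y, g y * ∏ i, mehler s (x i) (y i) ∂(stdPi ι) =
      ∫ y, g y ∂(Measure.pi fun i => gaussianReal (s * x i) (1 - s ^ 2).toNNReal) := by
  have hm : Measurable fun y : ι → ℝ => ∏ i, mehler s (x i) (y i) :=
    Finset.measurable_prod _ fun i _ => (measurable_mehler s (x i)).comp (measurable_pi_apply i)
  rw [pi_gaussianReal_eq_withDensity hs, integral_withDensity_eq_integral_toReal_smul
    hm.ennreal_ofReal (by simp)]
  refine integral_congr_ae (Eventually.of_forall fun y => ?_)
  simp only [smul_eq_mul]
  rw [ENNReal.toReal_ofReal (Finset.prod_nonneg fun i _ => mehler_nonneg _ _ _), mul_comm]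

theorem memLp_prod_mehler (hs : s ∈ Set.Ioo (0 : ℝ) 1) (x : ι → ℝ) :
    MemLp (fun y : ι → ℝ => ∏ i, mehler s (x i) (y i)) 2 (stdPi ι) := by
  have hm : Measurable fun y : ι → ℝ => ∏ i, mehler s (x i) (y i) :=
    Finset.measurable_prod _ fun i _ => (measurable_mehler s (x i)).comp (measurable_pi_apply i)
  rw [memLp_two_iff_integrable_sq hm.aestronglyMeasurable]
  simp_rw [← Finset.prod_pow]
  exact Integrable.fintype_prod_dep fun i => (memLp_mehler hs (x i)).integrable_sq

/-- Links the two forms of the Ornstein-Uhlenbeck average: an affine substitution in a standard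
Gaussian vector, and integration against the Mehler kernel. -/
theorem pi_map_affine (hs : s ∈ Set.Ioo (0 : ℝ) 1) (x : ι → ℝ) :
    (stdPi ι).map (fun a i => √(1 - s ^ 2) * a i + s * x i) =
      Measure.pi fun i => gaussianReal (s * x i) (1 - s ^ 2).toNNReal := by
  have h : ∀ i, (gaussianReal 0 1).map (fun a => √(1 - s ^ 2) * a + s * x i) =
      gaussianReal (s * x i) (1 - s ^ 2).toNNReal := by
    intro i
    have := gaussianReal_map_const_mul (μ := 0) (v := 1) (√(1 - s ^ 2))
    rw [show (fun a => √(1 - s ^ 2) * a + s * x i) =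
      (fun a => a + s * x i) ∘ (fun a => √(1 - s ^ 2) * a) from rfl,
      ← Measure.map_map (by fun_prop) (by fun_prop), this, gaussianReal_map_add_const]
    congr 1
    · ring
    · ext
      simp [Real.sq_sqrt (one_sub_sq_pos hs).le, (one_sub_sq_pos hs).le]
  have : ∀ i, SigmaFinite ((gaussianReal 0 1).map (fun a => √(1 - s ^ 2) * a + s * x i)) :=
    fun i => by rw [h]; infer_instance
  rw [stdPi, Measure.pi_map_pi (f := fun i a => √(1 - s ^ 2) * a + s * x i)
    (fun i => by fun_prop)]
  simp_rw [h]

/-- The squared `L²` norm of the remainder of the Mehler kernel after its first order part. -/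
noncomputable def mehlerRemainder (s : ℝ) (x : ι → ℝ) : ℝ :=
  ∏ i, mehlerSq s (x i) - 1 - s ^ 2 * ∑ i, x i ^ 2

theorem integral_linear_sq_stdPi (x : ι → ℝ) :
    ∫ y, (∑ i, x i * y i) ^ 2 ∂(stdPi ι) = ∑ i, x i ^ 2 := by
  have h1 := variance_sum_pi (μ := fun _ : ι => gaussianReal 0 1) (X := fun i y => x i * y)
    (fun i => (memLp_id_gaussianReal 2).const_mul _)
  have h2 : ∀ i, Var[fun y => x i * y; gaussianReal 0 1] = x i ^ 2 := fun i => by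
    rw [variance_const_mul]
    have := variance_fun_id_gaussianReal (μ := 0) (v := 1)
    simp [this]
  have h4 : (∑ i, fun y : ι → ℝ => x i * y i) = fun y => ∑ i, x i * y i := by ext; simp
  rw [h4] at h1
  have h3 : ∫ y : ι → ℝ, ∑ i, x i * y i ∂(stdPi ι) = 0 := by
    rw [integral_finsetSum _ fun i _ => ((memLp_eval_stdPi i).integrable one_le_two).const_mul _]
    refine Finset.sum_eq_zero fun i _ => ?_
    rw [integral_const_mul, integral_eval, integral_id_gaussianReal, mul_zero]
  rw [variance_of_integral_eq_zero _ h3] at h1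
  · simpa [h2] using h1
  · exact Measurable.aemeasurable (by fun_prop)

/-- Under the kernel, the coordinates have mean `s * x i`, so `1 + s * ∑ x i * y i` is the
projection of the kernel onto the affine functions, and the identity is Pythagoras. -/
theorem integral_mehler_remainder_sq (hs : s ∈ Set.Ioo (0 : ℝ) 1) (x : ι → ℝ) :
    ∫ y, (∏ i, mehler s (x i) (y i) - (1 + s * ∑ i, x i * y i)) ^ 2 ∂(stdPi ι) =
      mehlerRemainder s x := by
  have hM := memLp_prod_mehler hs x
  have hl : MemLp (fun y : ι → ℝ => ∑ i, x i * y i) 2 (stdPi ι) :=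
    memLp_finsetSum _ fun i _ => (memLp_eval_stdPi i).const_mul _
  set M : (ι → ℝ) → ℝ := fun y => ∏ i, mehler s (x i) (y i)
  set l : (ι → ℝ) → ℝ := fun y => ∑ i, x i * y i
  have hl0 : ∫ y, l y ∂(stdPi ι) = 0 := by
    simp only [l]
    rw [integral_finsetSum _ fun i _ => ((memLp_eval_stdPi i).integrable one_le_two).const_mul _]
    refine Finset.sum_eq_zero fun i _ => ?_
    rw [integral_const_mul, integral_eval, integral_id_gaussianReal, mul_zero]
  have hl2 : ∫ y, l y ^ 2 ∂(stdPi ι) = ∑ i, x i ^ 2 := integral_linear_sq_stdPi x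
  have hM1 : ∫ y, M y ∂(stdPi ι) = 1 := by
    simpa using integral_mul_prod_mehler hs x (fun _ => 1)
  have hlM : ∫ y, l y * M y ∂(stdPi ι) = s * ∑ i, x i ^ 2 := by
    rw [integral_mul_prod_mehler hs x l]
    simp only [l]
    rw [integral_finsetSum, Finset.mul_sum]
    · refine Finset.sum_congr rfl fun i _ => ?_
      rw [integral_const_mul, integral_eval, integral_id_gaussianReal]
      ring
    · exact fun i _ => (integrable_eval IsGaussian.integrable_id).const_mul _
  have hM2 : ∫ y, M y ^ 2 ∂(stdPi ι) = ∏ i, mehlerSq s (x i) := by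
    simp only [M, ← Finset.prod_pow]
    rw [integral_fintype_prod_eq_prod (f := fun i y => mehler s (x i) y ^ 2)]
    exact Finset.prod_congr rfl fun i _ => integral_mehler_sq hs (x i)
  have hexp : (fun y => (M y - (1 + s * l y)) ^ 2) = fun y =>
      (M y ^ 2 + l y ^ 2 * s ^ 2) + (l y * (2 * s) + 1) - (M y * 2 + l y * M y * (2 * s)) := by
    ext y; ring
  change ∫ y, (M y - (1 + s * l y)) ^ 2 ∂(stdPi ι) = _
  have i1 := hM.integrable_sq
  have i2 : Integrable (fun y => l y ^ 2 * s ^ 2) (stdPi ι) := hl.integrable_sq.mul_const _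
  have i3 : Integrable (fun y => l y * (2 * s)) (stdPi ι) := (hl.integrable one_le_two).mul_const _
  have i4 : Integrable (fun y => M y * 2) (stdPi ι) := (hM.integrable one_le_two).mul_const _
  have i5 : Integrable (fun y => l y * M y * (2 * s)) (stdPi ι) :=
    (hl.integrable_mul hM).mul_const _
  have i6 : Integrable (fun y => M y ^ 2 + l y ^ 2 * s ^ 2) (stdPi ι) := i1.add i2
  have i7 : Integrable (fun y => l y * (2 * s) + 1) (stdPi ι) := i3.add (integrable_const _)
  have i8 : Integrable (fun y => M y * 2 + l y * M y * (2 * s)) (stdPi ι) := i4.add i5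
  have i9 : Integrable (fun y => M y ^ 2 + l y ^ 2 * s ^ 2 + (l y * (2 * s) + 1)) (stdPi ι) :=
    i6.add i7
  rw [hexp, integral_sub i9 i8, integral_add i6 i7, integral_add i1 i2,
    integral_add i3 (integrable_const _), integral_add i4 i5, integral_mul_const,
    integral_mul_const, integral_mul_const, integral_mul_const, hl0, hl2, hM1, hlM, hM2,
    mehlerRemainder]
  simp
  ring

theorem integrable_mehlerRemainder (hs : s ∈ Set.Ioo (0 : ℝ) 1) :
    Integrable (mehlerRemainder s) (stdPi ι) :=
  ((Integrable.fintype_prod_dep fun _ => integrable_mehlerSq hs).sub (integrable_const _)).sub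
    ((integrable_finsetSum _ fun i _ => (memLp_eval_stdPi i).integrable_sq).const_mul _)

/-- The two subtracted terms are the first two of the expansion in `s ^ 2`; what remains is of order
`s ^ 4`. -/
theorem integral_mehlerRemainder (hs : s ∈ Set.Ioo (0 : ℝ) 1) :
    ∫ x, mehlerRemainder s x ∂(stdPi ι) =
      ((1 - s ^ 2)⁻¹) ^ Fintype.card ι - 1 - s ^ 2 * Fintype.card ι := by
  have i1 : Integrable (fun x : ι → ℝ => ∏ i, mehlerSq s (x i)) (stdPi ι) :=
    Integrable.fintype_prod_dep fun _ => integrable_mehlerSq hs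
  have i2 : Integrable (fun x : ι → ℝ => ∑ i, x i ^ 2) (stdPi ι) :=
    integrable_finsetSum _ fun i _ => (memLp_eval_stdPi i).integrable_sq
  have h2 := integral_linear_sq_stdPi (ι := ι)
  unfold mehlerRemainder
  have i3 : Integrable (fun x : ι → ℝ => ∏ i, mehlerSq s (x i) - 1) (stdPi ι) :=
    i1.sub (integrable_const _)
  rw [integral_sub i3 (i2.const_mul _), integral_sub i1
    (integrable_const _), integral_fintype_prod_eq_prod (f := fun _ x => mehlerSq s x),
    integral_const_mul, integral_finsetSum _ fun i _ => (memLp_eval_stdPi i).integrable_sq]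
  have h3 : ∀ i : ι, ∫ x : ι → ℝ, x i ^ 2 ∂(stdPi ι) = 1 := by
    classical
    intro i
    have := h2 (Pi.single i 1)
    simpa [Pi.single_apply] using this
  simp [h3, integral_mehlerSq hs]

/-- Second order smallness of the Ornstein-Uhlenbeck semigroup on functions orthogonal to the
polynomials of degree at most one. -/
theorem sq_integral_affine_le (hs : s ∈ Set.Ioo (0 : ℝ) 1) {g : (ι → ℝ) → ℝ} (hgm : Measurable g)
    (hg : MemLp g 2 (stdPi ι)) (hg0 : ∫ y, g y ∂(stdPi ι) = 0)
    (hg1 : ∀ i, ∫ y, g y * y i ∂(stdPi ι) = 0) (x : ι → ℝ) :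
    (∫ a, g (fun i => √(1 - s ^ 2) * a i + s * x i) ∂(stdPi ι)) ^ 2 ≤
      (∫ y, g y ^ 2 ∂(stdPi ι)) * mehlerRemainder s x := by
  have hM := memLp_prod_mehler hs x
  have hl : MemLp (fun y : ι → ℝ => ∑ i, x i * y i) 2 (stdPi ι) :=
    memLp_finsetSum _ fun i _ => (memLp_eval_stdPi i).const_mul _
  have hone : MemLp (fun _ : ι → ℝ => (1 : ℝ)) 2 (stdPi ι) := memLp_const 1
  have hlin : MemLp (fun y : ι → ℝ => 1 + s * ∑ i, x i * y i) 2 (stdPi ι) :=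
    hone.add (hl.const_mul s)
  have h1 : ∫ a, g (fun i => √(1 - s ^ 2) * a i + s * x i) ∂(stdPi ι) =
      ∫ y, g y * ∏ i, mehler s (x i) (y i) ∂(stdPi ι) := by
    rw [integral_mul_prod_mehler hs, ← pi_map_affine hs x, integral_map
      (Measurable.aemeasurable (by fun_prop)) hgm.aestronglyMeasurable]
  -- Orthogonality of `g` to the affine functions allows the affine part of the kernel to be
  -- subtracted at no cost.
  have h2 : ∫ y, g y * (1 + s * ∑ i, x i * y i) ∂(stdPi ι) = 0 := by
    have : (fun y : ι → ℝ => g y * (1 + s * ∑ i, x i * y i)) =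
        fun y => g y + ∑ i, (g y * y i) * (s * x i) := by
      ext y
      rw [mul_add, mul_one, Finset.mul_sum, Finset.mul_sum]
      congr 1
      exact Finset.sum_congr rfl fun i _ => by ring
    have hi : ∀ i, Integrable (fun y : ι → ℝ => (g y * y i) * (s * x i)) (stdPi ι) := fun i =>
      Integrable.mul_const (f := fun y : ι → ℝ => g y * y i)
        (hg.integrable_mul (memLp_eval_stdPi i)) _
    rw [this, integral_add (hg.integrable one_le_two) (integrable_finsetSum _ fun i _ => hi i),
      integral_finsetSum _ fun i _ => hi i, hg0]
    simp [integral_mul_const, hg1]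
  have h3 : ∫ a, g (fun i => √(1 - s ^ 2) * a i + s * x i) ∂(stdPi ι) =
      ∫ y, g y * (∏ i, mehler s (x i) (y i) - (1 + s * ∑ i, x i * y i)) ∂(stdPi ι) := by
    have e1 : Integrable (fun y => g y * ∏ i, mehler s (x i) (y i)) (stdPi ι) :=
      hg.integrable_mul hM
    have e2 : Integrable (fun y => g y * (1 + s * ∑ i, x i * y i)) (stdPi ι) :=
      hg.integrable_mul hlin
    simp_rw [mul_sub]
    rw [integral_sub e1 e2, h2, sub_zero, h1]
  rw [h3, ← integral_mehler_remainder_sq hs x]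
  exact sq_integral_mul_le hg (hM.sub hlin)

end

/-! ### Decoupling of weakly correlated Gaussian vectors -/

/-- A Gaussian law is determined by its means and covariances. -/
theorem map_eq_of_hasGaussianLaw {κ : Type*} [Fintype κ] {Ω Ω' : Type*} [MeasurableSpace Ω]
    [MeasurableSpace Ω'] {P : Measure Ω} {P' : Measure Ω'} {X : Ω → κ → ℝ} {Y : Ω' → κ → ℝ}
    (hX : HasGaussianLaw X P) (hY : HasGaussianLaw Y P')
    (hmean : ∀ k, ∫ ω, X ω k ∂P = ∫ ω, Y ω k ∂P')
    (hcov : ∀ k l, cov[fun ω => X ω k, fun ω => X ω l; P] = cov[fun ω => Y ω k, fun ω => Y ω l; P']) :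
    P.map X = P'.map Y := by
  classical
  have := hX.isProbabilityMeasure
  have := hY.isProbabilityMeasure
  have := Measure.isProbabilityMeasure_map hX.aemeasurable
  have := Measure.isProbabilityMeasure_map hY.aemeasurable
  have hX2 : ∀ k, MemLp (fun ω => X ω k) 2 P := fun k => (hX.eval k).memLp_two
  have hY2 : ∀ k, MemLp (fun ω => Y ω k) 2 P' := fun k => (hY.eval k).memLp_two
  refine Measure.ext_of_charFunDual (funext fun L => ?_)
  have hL : ∀ x : κ → ℝ, L x = ∑ k, L (Pi.single k 1) * x k := fun x => by
    have := LinearMap.pi_apply_eq_sum_univ (L : (κ → ℝ) →ₗ[ℝ] ℝ) x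
    simp only [ContinuousLinearMap.coe_coe, smul_eq_mul] at this
    rw [this]
    refine Finset.sum_congr rfl fun k _ => ?_
    rw [mul_comm]
    congr 2
    ext j
    rw [Pi.single_apply]
    exact if_congr eq_comm rfl rfl
  rw [hX.charFunDual_map_eq_fun, hY.charFunDual_map_eq_fun]
  have hLX : ∀ ω, L (X ω) = ∑ k, L (Pi.single k 1) * X ω k := fun ω => hL _
  have hLY : ∀ ω, L (Y ω) = ∑ k, L (Pi.single k 1) * Y ω k := fun ω => hL _
  simp only [hLX, hLY]
  rw [integral_finsetSum _ fun k _ => ((hX2 k).integrable one_le_two).const_mul _,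
    integral_finsetSum _ fun k _ => ((hY2 k).integrable one_le_two).const_mul _,
    variance_fun_sum fun k => (hX2 k).const_mul _, variance_fun_sum fun k => (hY2 k).const_mul _]
  simp_rw [integral_const_mul, covariance_const_mul_left, covariance_const_mul_right, hmean, hcov]

theorem hasGaussianLaw_id_stdPi (κ : Type*) [Fintype κ] :
    HasGaussianLaw (fun x : κ → ℝ => x) (stdPi κ) :=
  iIndepFun.hasGaussianLaw (X := fun (k : κ) (x : κ → ℝ) => x k)
    (fun k => HasLaw.hasGaussianLaw (μ := gaussianReal 0 1)
      ⟨(measurable_pi_apply k).aemeasurable, (measurePreserving_eval _ k).map_eq⟩)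
    (iIndepFun_pi (X := fun _ x => x) fun _ => aemeasurable_id)

theorem covariance_eval_stdPi {κ : Type*} [Fintype κ] [DecidableEq κ] (k l : κ) :
    cov[fun x : κ → ℝ => x k, fun x => x l; stdPi κ] = if k = l then 1 else 0 := by
  split_ifs with h
  · subst h
    rw [covariance_self (measurable_pi_apply k).aemeasurable]
    have := (measurePreserving_eval (fun _ : κ => gaussianReal 0 1) k).map_eq
    have h2 := variance_map (μ := stdPi κ) (X := id) (Y := Function.eval k) (by fun_prop)
      (measurable_pi_apply k).aemeasurable
    rw [this, variance_id_gaussianReal] at h2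
    exact h2.symm
  · exact ((iIndepFun_pi (μ := fun _ : κ => gaussianReal 0 1) (X := fun _ x => x)
      fun _ => aemeasurable_id).indepFun h).covariance_eq_zero (memLp_eval_stdPi k)
      (memLp_eval_stdPi l)

/-- A Gaussian vector whose covariance matrix is `(1 - s²) 1 + s² S`, with `S` positive
semidefinite, has the law of `√(1 - s²) a + s w`, where `a` is standard Gaussian and `w` is an
independent Gaussian vector with covariance matrix `S`. -/
theorem map_eq_map_prod_multivariateGaussian {κ : Type*} [Fintype κ] [DecidableEq κ] {Ω : Type*}
    [MeasurableSpace Ω] {P : Measure Ω} {Z : Ω → κ → ℝ} (hZ : HasGaussianLaw Z P)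
    (hmean : ∀ k, ∫ ω, Z ω k ∂P = 0) {s : ℝ} (hs : s ∈ Set.Ioo (0 : ℝ) 1) {S : Matrix κ κ ℝ}
    (hS : S.PosSemidef)
    (hcov : ∀ k l, cov[fun ω => Z ω k, fun ω => Z ω l; P] =
      (1 - s ^ 2) * (if k = l then 1 else 0) + s ^ 2 * S k l) :
    P.map Z = ((stdPi κ).prod (multivariateGaussian 0 S)).map
      fun p k => √(1 - s ^ 2) * p.1 k + s * p.2 k := by
  set ν := multivariateGaussian (0 : EuclideanSpace ℝ κ) S
  have hν : HasGaussianLaw (fun w : EuclideanSpace ℝ κ => w) ν := IsGaussian.hasGaussianLaw_id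
  have : IsGaussian (stdPi κ) := by
    have := (hasGaussianLaw_id_stdPi κ).isGaussian_map
    rwa [Measure.map_id'] at this
  have hid : HasGaussianLaw (fun p : (κ → ℝ) × EuclideanSpace ℝ κ => p) ((stdPi κ).prod ν) :=
    IsGaussian.hasGaussianLaw_id
  have hw2 : ∀ k, MemLp (fun w : EuclideanSpace ℝ κ => w k) 2 ν := fun k =>
    (hν.map_fun (EuclideanSpace.proj k)).memLp_two
  have hw0 : ∀ k, ∫ w, w k ∂ν = 0 := fun k => by
    have := ContinuousLinearMap.integral_comp_comm (EuclideanSpace.proj (𝕜 := ℝ) k)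
      (hν.integrable)
    simpa [ν] using this
  have hgm : HasGaussianLaw (fun (p : (κ → ℝ) × EuclideanSpace ℝ κ) k =>
      √(1 - s ^ 2) * p.1 k + s * p.2 k) ((stdPi κ).prod ν) := by
    let T : (κ → ℝ) × EuclideanSpace ℝ κ →L[ℝ] (κ → ℝ) :=
      √(1 - s ^ 2) • ContinuousLinearMap.fst ℝ _ _ +
        s • ((EuclideanSpace.equiv κ ℝ).toContinuousLinearMap.comp (ContinuousLinearMap.snd ℝ _ _))
    exact hid.map_fun T
  have h1 : ∀ k, MemLp (fun p : (κ → ℝ) × EuclideanSpace ℝ κ => p.1 k) 2 ((stdPi κ).prod ν) :=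
    fun k => (memLp_eval_stdPi k).comp_measurePreserving measurePreserving_fst
  have h2 : ∀ k, MemLp (fun p : (κ → ℝ) × EuclideanSpace ℝ κ => p.2 k) 2 ((stdPi κ).prod ν) :=
    fun k => (hw2 k).comp_measurePreserving measurePreserving_snd
  refine map_eq_of_hasGaussianLaw hZ hgm (fun k => ?_) (fun k l => ?_)
  · rw [hmean, integral_add (((h1 k).integrable one_le_two).const_mul _)
      (((h2 k).integrable one_le_two).const_mul _), integral_const_mul, integral_const_mul,
      integral_fun_fst (fun x : κ → ℝ => x k), integral_fun_snd (fun w : EuclideanSpace ℝ κ => w k),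
      hw0, integral_eval, integral_id_gaussianReal]
    simp
  · have c1 : cov[fun p : (κ → ℝ) × EuclideanSpace ℝ κ => p.1 k, fun p => p.1 l;
        (stdPi κ).prod ν] = if k = l then 1 else 0 := by
      rw [← covariance_eval_stdPi k l]
      have := covariance_map (μ := (stdPi κ).prod ν) (Z := Prod.fst)
        (X := fun x : κ → ℝ => x k) (Y := fun x => x l)
        (measurable_pi_apply k).aestronglyMeasurable
        (measurable_pi_apply l).aestronglyMeasurable (by fun_prop)
      rw [measurePreserving_fst.map_eq] at this
      exact this.symm
    have c2 : cov[fun p : (κ → ℝ) × EuclideanSpace ℝ κ => p.2 k, fun p => p.2 l;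
        (stdPi κ).prod ν] = S k l := by
      rw [← covariance_eval_multivariateGaussian (μ := 0) hS k l]
      have := covariance_map (μ := (stdPi κ).prod ν) (Z := Prod.snd)
        (X := fun x : EuclideanSpace ℝ κ => x k) (Y := fun x => x l)
        (Measurable.aestronglyMeasurable (by fun_prop))
        (Measurable.aestronglyMeasurable (by fun_prop)) (by fun_prop)
      rw [measurePreserving_snd.map_eq] at this
      exact this.symm
    have c3 : ∀ k l, cov[fun p : (κ → ℝ) × EuclideanSpace ℝ κ => p.1 k, fun p => p.2 l;
        (stdPi κ).prod ν] = 0 := fun k l =>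
      (indepFun_prod (μ := stdPi κ) (ν := ν) (X := fun x => x k) (Y := fun w => w l)
        (measurable_pi_apply k) (by fun_prop)).covariance_eq_zero (h1 k) (h2 l)
    have c4 := c3 l k
    rw [covariance_comm] at c4
    have hsq : √(1 - s ^ 2) * √(1 - s ^ 2) = 1 - s ^ 2 :=
      Real.mul_self_sqrt (one_sub_sq_pos hs).le
    rw [hcov]
    change _ = cov[(fun p : (κ → ℝ) × EuclideanSpace ℝ κ => √(1 - s ^ 2) * p.1 k) +
      (fun p => s * p.2 k), (fun p => √(1 - s ^ 2) * p.1 l) + (fun p => s * p.2 l);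
        (stdPi κ).prod ν]
    rw [covariance_add_left ((h1 k).const_mul _) ((h2 k).const_mul _)
        (((h1 l).const_mul _).add ((h2 l).const_mul _)),
      covariance_add_right ((h1 k).const_mul _) ((h1 l).const_mul _) ((h2 l).const_mul _),
      covariance_add_right ((h2 k).const_mul _) ((h1 l).const_mul _) ((h2 l).const_mul _)]
    simp only [covariance_const_mul_left, covariance_const_mul_right]
    rw [c1, c2, c3, c4]
    linear_combination (-(if k = l then 1 else 0 : ℝ)) * hsq

/-- By `2 |a b| ≤ a² + b²` and entries at most `1 / card ι`, the cross terms are bounded by the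
identity blocks. This makes the block matrix an admissible covariance for `w`. -/
theorem posSemidef_fromBlocks_one {ι : Type*} [Fintype ι] [DecidableEq ι] {M : Matrix ι ι ℝ}
    (hM : ∀ i j, |M i j| * Fintype.card ι ≤ 1) :
    (Matrix.fromBlocks 1 M M.transpose 1).PosSemidef := by
  refine Matrix.PosSemidef.of_dotProduct_mulVec_nonneg ?_ fun x => ?_
  · rw [Matrix.IsHermitian, Matrix.fromBlocks_conjTranspose]
    simp [Matrix.conjTranspose_eq_transpose_of_trivial]
  · have hx : star x ⬝ᵥ (Matrix.fromBlocks 1 M M.transpose 1).mulVec x =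
        ∑ i, x (.inl i) ^ 2 + ∑ j, x (.inr j) ^ 2 +
          2 * ∑ i, ∑ j, x (.inl i) * M i j * x (.inr j) := by
      rw [Matrix.fromBlocks_mulVec]
      simp only [dotProduct, Fintype.sum_sum_type, Sum.elim_inl, Sum.elim_inr, Pi.add_apply,
        Matrix.one_mulVec, Function.comp, star_trivial, Matrix.mulVec, Matrix.transpose_apply,
        mul_add, Finset.sum_add_distrib, Finset.mul_sum]
      have : ∑ j, ∑ i, x (.inr j) * (M i j * x (.inl i)) =
          ∑ i, ∑ j, x (.inl i) * (M i j * x (.inr j)) := by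
        rw [Finset.sum_comm]
        exact Finset.sum_congr rfl fun i _ => Finset.sum_congr rfl fun j _ => by ring
      rw [this]
      simp only [← mul_assoc, ← sq, two_mul, add_mul, Finset.sum_add_distrib]
      ring
    rw [hx]
    set N : ℝ := (Fintype.card ι : ℝ) with hNdef
    rcases isEmpty_or_nonempty ι with hι | hι
    · simp
    have hN : 0 < N := by rw [hNdef]; exact_mod_cast Fintype.card_pos
    have hterm : ∀ i j, -((x (.inl i) ^ 2 + x (.inr j) ^ 2) / (2 * N)) ≤
        x (.inl i) * M i j * x (.inr j) := by
      intro i j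
      have h1 : |M i j| ≤ 1 / N := by rw [le_div_iff₀ hN]; exact hM i j
      have h2 : |x (.inl i) * M i j * x (.inr j)| ≤ (x (.inl i) ^ 2 + x (.inr j) ^ 2) / (2 * N) := by
        rw [abs_mul, abs_mul]
        have h3 : |x (.inl i)| * |x (.inr j)| ≤ (x (.inl i) ^ 2 + x (.inr j) ^ 2) / 2 := by
          have := sq_nonneg (|x (.inl i)| - |x (.inr j)|)
          rw [← sq_abs (x (.inl i)), ← sq_abs (x (.inr j))]
          linarith
        calc |x (.inl i)| * |M i j| * |x (.inr j)| = (|x (.inl i)| * |x (.inr j)|) * |M i j| := by ring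
          _ ≤ ((x (.inl i) ^ 2 + x (.inr j) ^ 2) / 2) * (1 / N) := by gcongr
          _ = _ := by field_simp
      exact (abs_le.1 h2).1
    have hsum : ∑ i : ι, ∑ j : ι, -((x (.inl i) ^ 2 + x (.inr j) ^ 2) / (2 * N)) =
        -((∑ i, x (.inl i) ^ 2 + ∑ j, x (.inr j) ^ 2) / 2) := by
      simp only [Finset.sum_neg_distrib, ← Finset.sum_div, Finset.sum_add_distrib,
        Finset.sum_const, Finset.card_univ, nsmul_eq_mul, ← Finset.mul_sum]
      rw [← hNdef]
      field_simp
    have := Finset.sum_le_sum fun i (_ : i ∈ Finset.univ) =>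
      Finset.sum_le_sum fun j (_ : j ∈ Finset.univ) => hterm i j
    rw [hsum] at this
    linarith

theorem integral_mul_sumElim_stdPi {ι : Type*} [Fintype ι] (G H : (ι → ℝ) → ℝ) :
    ∫ a : ι ⊕ ι → ℝ, G (fun i => a (.inl i)) * H (fun i => a (.inr i)) ∂(stdPi (ι ⊕ ι)) =
      (∫ a, G a ∂(stdPi ι)) * ∫ a, H a ∂(stdPi ι) := by
  rw [← integral_prod_mul]
  exact (measurePreserving_sumPiEquivProdPi fun _ : ι ⊕ ι => gaussianReal 0 1).integral_comp'
    fun p => G p.1 * H p.2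

/-- If `g` is orthogonal to the polynomials of degree at most one in `L²` of the standard Gaussian
measure, then the covariance of `g U` and `g V` is of second order in the cross-covariance of the
jointly Gaussian standard vectors `U` and `V`. -/
theorem abs_integral_mul_le_of_hasGaussianLaw {ι : Type*} [Fintype ι] [DecidableEq ι] {Ω : Type*}
    [MeasurableSpace Ω] {P : Measure Ω} {Z : Ω → ι ⊕ ι → ℝ} (hZ : HasGaussianLaw Z P)
    (hmean : ∀ k, ∫ ω, Z ω k ∂P = 0)
    (hl : ∀ i j, cov[fun ω => Z ω (.inl i), fun ω => Z ω (.inl j); P] = if i = j then 1 else 0)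
    (hr : ∀ i j, cov[fun ω => Z ω (.inr i), fun ω => Z ω (.inr j); P] = if i = j then 1 else 0)
    {s : ℝ} (hs : s ∈ Set.Ioo (0 : ℝ) 1)
    (hlr : ∀ i j, |cov[fun ω => Z ω (.inl i), fun ω => Z ω (.inr j); P]| * Fintype.card ι ≤ s ^ 2)
    {g : (ι → ℝ) → ℝ} (hgm : Measurable g) (hg : MemLp g 2 (stdPi ι))
    (hg0 : ∫ y, g y ∂(stdPi ι) = 0) (hg1 : ∀ i, ∫ y, g y * y i ∂(stdPi ι) = 0) :
    |∫ ω, g (fun i => Z ω (.inl i)) * g (fun i => Z ω (.inr i)) ∂P| ≤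
      (∫ y, g y ^ 2 ∂(stdPi ι)) *
        (((1 - s ^ 2)⁻¹) ^ Fintype.card ι - 1 - s ^ 2 * Fintype.card ι) := by
  have hs0 : 0 < s ^ 2 := pow_pos hs.1 2
  -- Division by `s ^ 2` moves the entire cross-covariance into `w`, whose diagonal blocks remain
  -- the identity.
  set M : Matrix ι ι ℝ := Matrix.of fun i j =>
    cov[fun ω => Z ω (.inl i), fun ω => Z ω (.inr j); P] / s ^ 2
  have hM : ∀ i j, |M i j| * Fintype.card ι ≤ 1 := fun i j => by
    simp only [M, Matrix.of_apply]
    rw [abs_div, abs_of_pos hs0, div_mul_eq_mul_div, div_le_one hs0]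
    exact hlr i j
  set S := Matrix.fromBlocks 1 M M.transpose 1 with hSdef
  have hS : S.PosSemidef := posSemidef_fromBlocks_one hM
  have hMs : ∀ i j, s ^ 2 * M i j = cov[fun ω => Z ω (.inl i), fun ω => Z ω (.inr j); P] :=
    fun i j => by simp only [M, Matrix.of_apply]; exact mul_div_cancel₀ _ hs0.ne'
  have hlaw := map_eq_map_prod_multivariateGaussian hZ hmean hs hS (by
    rintro (i | i) (j | j)
    · rw [hl, hSdef, Matrix.fromBlocks_apply₁₁, Matrix.one_apply]
      simp only [Sum.inl.injEq]
      ring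
    · rw [hSdef, Matrix.fromBlocks_apply₁₂, hMs]
      simp
    · rw [hSdef, Matrix.fromBlocks_apply₂₁, Matrix.transpose_apply, hMs, covariance_comm]
      simp
    · rw [hr, hSdef, Matrix.fromBlocks_apply₂₂, Matrix.one_apply]
      simp only [Sum.inr.injEq]
      ring)
  set ν := multivariateGaussian (0 : EuclideanSpace ℝ (ι ⊕ ι)) S with hν
  have hνG : HasGaussianLaw (fun w : EuclideanSpace ℝ (ι ⊕ ι) => w) ν :=
    IsGaussian.hasGaussianLaw_id
  have hstd : ∀ e : ι → ι ⊕ ι, (∀ i j, S (e i) (e j) = if i = j then 1 else 0) →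
      ν.map (fun w i => w (e i)) = stdPi ι := by
    intro e he
    have hG : HasGaussianLaw (fun (w : EuclideanSpace ℝ (ι ⊕ ι)) i => w (e i)) ν :=
      hνG.map_fun (ContinuousLinearMap.pi fun i => EuclideanSpace.proj (e i))
    rw [map_eq_of_hasGaussianLaw hG (hasGaussianLaw_id_stdPi ι), Measure.map_id']
    · intro k
      have := ContinuousLinearMap.integral_comp_comm (EuclideanSpace.proj (𝕜 := ℝ) (e k))
        (hνG.integrable)
      have h2 : ∫ w, w (e k) ∂ν = 0 := by simpa [hν] using this
      rw [h2, integral_eval, integral_id_gaussianReal]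
    · intro k l
      rw [covariance_eval_stdPi, covariance_eval_multivariateGaussian hS, he]
  have hZstd : ∀ e : ι → ι ⊕ ι, (∀ i j, cov[fun ω => Z ω (e i), fun ω => Z ω (e j); P] =
      if i = j then 1 else 0) → MemLp (fun ω => g fun i => Z ω (e i)) 2 P := by
    intro e he
    have hG : HasGaussianLaw (fun ω i => Z ω (e i)) P :=
      hZ.map_fun (ContinuousLinearMap.pi fun i => ContinuousLinearMap.proj (e i))
    have hm := map_eq_of_hasGaussianLaw hG (hasGaussianLaw_id_stdPi ι)
      (fun k => by rw [hmean, integral_eval, integral_id_gaussianReal])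
      (fun k l => by rw [he, covariance_eval_stdPi])
    rw [Measure.map_id'] at hm
    exact (memLp_map_measure_iff (hm ▸ hg.1) hG.aemeasurable).1 (hm ▸ hg)
  have hint : Integrable (fun ω => g (fun i => Z ω (.inl i)) * g (fun i => Z ω (.inr i))) P :=
    (hZstd .inl hl).integrable_mul (hZstd .inr hr)
  set T : (ι ⊕ ι → ℝ) × EuclideanSpace ℝ (ι ⊕ ι) → ι ⊕ ι → ℝ :=
    fun p k => √(1 - s ^ 2) * p.1 k + s * p.2 k
  have hT : Measurable T := by fun_prop
  set φ : (ι ⊕ ι → ℝ) → ℝ := fun z => g (fun i => z (.inl i)) * g (fun i => z (.inr i)) with hφ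
  have hφm : Measurable φ := by fun_prop
  have hint2 : Integrable (fun p => φ (T p)) ((stdPi (ι ⊕ ι)).prod ν) := by
    have : Integrable φ (P.map Z) :=
      (integrable_map_measure hφm.aestronglyMeasurable hZ.aemeasurable).2 hint
    rw [hlaw] at this
    exact (integrable_map_measure hφm.aestronglyMeasurable hT.aemeasurable).1 this
  set F : (ι → ℝ) → ℝ := fun x => ∫ a, g (fun i => √(1 - s ^ 2) * a i + s * x i) ∂(stdPi ι)
  have hfub : ∫ ω, g (fun i => Z ω (.inl i)) * g (fun i => Z ω (.inr i)) ∂P =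
      ∫ w, F (fun i => w (.inl i)) * F (fun i => w (.inr i)) ∂ν := by
    calc ∫ ω, φ (Z ω) ∂P = ∫ z, φ z ∂(P.map Z) :=
          (integral_map hZ.aemeasurable hφm.aestronglyMeasurable).symm
      _ = ∫ p, φ (T p) ∂((stdPi (ι ⊕ ι)).prod ν) := by
          rw [hlaw, integral_map hT.aemeasurable hφm.aestronglyMeasurable]
      -- With `w` fixed, the two halves of `a` are independent, so the inner integral factorises
      -- into two values of `F`.
      _ = ∫ w, ∫ a, φ (T (a, w)) ∂(stdPi (ι ⊕ ι)) ∂ν := integral_prod_symm _ hint2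
      _ = _ := by
          refine integral_congr_ae (Eventually.of_forall fun w => ?_)
          exact integral_mul_sumElim_stdPi
            (fun a => g fun i => √(1 - s ^ 2) * a i + s * w (.inl i))
            (fun a => g fun i => √(1 - s ^ 2) * a i + s * w (.inr i))
  have hF : ∀ x, F x ^ 2 ≤ (∫ y, g y ^ 2 ∂(stdPi ι)) * mehlerRemainder s x :=
    sq_integral_affine_le hs hgm hg hg0 hg1
  have hmarg : ∀ e : ι → ι ⊕ ι, (∀ i j, S (e i) (e j) = if i = j then 1 else 0) →
      Integrable (fun w : EuclideanSpace ℝ (ι ⊕ ι) => mehlerRemainder s fun i => w (e i)) ν ∧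
      ∫ w, mehlerRemainder s (fun i => w (e i)) ∂ν =
        ((1 - s ^ 2)⁻¹) ^ Fintype.card ι - 1 - s ^ 2 * Fintype.card ι := by
    intro e he
    have hm : AEMeasurable (fun (w : EuclideanSpace ℝ (ι ⊕ ι)) i => w (e i)) ν :=
      Measurable.aemeasurable (by fun_prop)
    have h1 := integrable_mehlerRemainder (ι := ι) hs
    rw [← integral_mehlerRemainder hs]
    rw [← hstd e he] at h1 ⊢
    exact ⟨(integrable_map_measure h1.1 hm).1 h1, (integral_map hm h1.1).symm⟩
  have hSl : ∀ i j, S (.inl i) (.inl j) = if i = j then 1 else 0 := fun i j => by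
    rw [hSdef, Matrix.fromBlocks_apply₁₁, Matrix.one_apply]
  have hSr : ∀ i j, S (.inr i) (.inr j) = if i = j then 1 else 0 := fun i j => by
    rw [hSdef, Matrix.fromBlocks_apply₂₂, Matrix.one_apply]
  obtain ⟨i1, e1⟩ := hmarg .inl hSl
  obtain ⟨i2, e2⟩ := hmarg .inr hSr
  rw [hfub, ← Real.norm_eq_abs]
  -- `|F F'| ≤ (F² + F'²) / 2`, and each half of `w` is standard Gaussian, so both squares have the
  -- same bound in mean.
  refine (norm_integral_le_of_norm_le
    (((i1.const_mul (∫ y, g y ^ 2 ∂(stdPi ι))).add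
      (i2.const_mul (∫ y, g y ^ 2 ∂(stdPi ι)))).div_const 2)
    (Eventually.of_forall fun w => ?_)).trans_eq ?_
  · have h1 := hF fun i => w (.inl i)
    have h2 := hF fun i => w (.inr i)
    rw [Real.norm_eq_abs, abs_mul]
    have := sq_nonneg (|F fun i => w (.inl i)| - |F fun i => w (.inr i)|)
    rw [sub_sq, sq_abs, sq_abs] at this
    simp only [Pi.add_apply]
    linarith
  · simp only [Pi.add_apply]
    rw [integral_div, integral_add (i1.const_mul _) (i2.const_mul _), integral_const_mul,
      integral_const_mul, e1, e2]
    ring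

/-- Used with `t = s ^ 2` to make the second-order smallness explicit. The constant `4 ^ h` is
crude: it absorbs every second-order term produced by multiplying with `(1 - t)⁻¹ ≤ 1 + t + 2 t²`.
-/
theorem inv_pow_sub_le {h : ℕ} {t : ℝ} (ht0 : 0 ≤ t) (ht : t ≤ 1 / 2) :
    ((1 - t)⁻¹) ^ h - 1 - t * h ≤ (4 : ℝ) ^ h * t ^ 2 := by
  have h4 : ∀ h : ℕ, (h : ℝ) + 1 ≤ 4 ^ h := fun h => by
    have := one_add_mul_le_pow (show (-2 : ℝ) ≤ 3 by norm_num) h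
    norm_num at this
    nlinarith [(Nat.cast_nonneg h : (0 : ℝ) ≤ h)]
  have h1 : (1 - t)⁻¹ ≤ 1 + t + 2 * t ^ 2 := by
    rw [inv_le_iff_one_le_mul₀ (by linarith)]
    nlinarith [mul_nonneg (sq_nonneg t) (by linarith : 0 ≤ 1 - 2 * t)]
  have h0 : 0 ≤ (1 - t)⁻¹ := inv_nonneg.2 (by linarith)
  induction h with
  | zero => simp; positivity
  | succ h ih =>
    have hC := h4 h
    set C : ℝ := 4 ^ h
    have hC0 : 0 < C := by positivity
    have hh : (0 : ℝ) ≤ h := h.cast_nonneg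
    rw [pow_succ, pow_succ]
    push_cast
    have h5 : ((1 - t)⁻¹) ^ h * (1 - t)⁻¹ ≤ (1 + h * t + C * t ^ 2) * (1 + t + 2 * t ^ 2) :=
      mul_le_mul (by linarith) h1 h0 (by positivity)
    have h6 : t ^ 3 * (2 * h + C) ≤ t ^ 2 * (h + C / 2) := by
      have : t ^ 2 * t * (2 * h + C) ≤ t ^ 2 * (1 / 2) * (2 * h + C) := by gcongr
      linarith
    have h7 : C * t ^ 4 ≤ C * t ^ 2 * (1 / 4) := by
      have : t ^ 2 ≤ 1 / 4 := by nlinarith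
      calc C * t ^ 4 = C * t ^ 2 * t ^ 2 := by ring
        _ ≤ _ := by gcongr
    have h8 : t ^ 2 * (h + 1) ≤ t ^ 2 * C := by gcongr
    linarith

/-! ### Nondegeneracy of stationary sequences with vanishing autocovariance -/

/-- If `x h` lies in the span `W` of its predecessors, the same relation holds at every shift, so
all `x t` lie in `W`. Since `r → 0`, their inner products with each vector of `W` tend to 0; in
finite dimension this forces `‖x t‖ → 0`, although all norms are 1. -/
theorem linearIndependent_of_stationary {H : Type*} [NormedAddCommGroup H] [InnerProductSpace ℝ H]
    {x : ℕ → H} {r : ℕ → ℝ} (hr : ∀ s t, inner ℝ (x s) (x t) = r ((s : ℤ) - t).natAbs)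
    (h0 : r 0 = 1) (hlim : Tendsto r atTop (𝓝 0)) (h : ℕ) :
    LinearIndependent ℝ fun i : Fin h => x i := by
  induction h with
  | zero => exact linearIndependent_empty_type
  | succ h ih =>
    rw [linearIndependent_finSucc']
    refine ⟨ih, fun hmem => ?_⟩
    set W := Submodule.span ℝ (Set.range fun i : Fin h => x i) with hW
    change x h ∈ W at hmem
    obtain ⟨b, hb⟩ := (Submodule.mem_span_range_iff_exists_fun ℝ).1 hmem
    have hnorm : ∀ (c : Fin (h + 1) → ℝ) (t : ℕ), ‖∑ i, c i • x (i + t)‖ ^ 2 =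
        ∑ i, ∑ j, c i * c j * r (((i : ℕ) : ℤ) - ((j : ℕ) : ℤ)).natAbs := by
      intro c t
      rw [← real_inner_self_eq_norm_sq, sum_inner]
      refine Finset.sum_congr rfl fun i _ => ?_
      rw [inner_sum]
      refine Finset.sum_congr rfl fun j _ => ?_
      rw [real_inner_smul_left, real_inner_smul_right, hr, mul_assoc]
      congr 4
      push_cast
      ring
    -- The combination with coefficients `b` and `-1` vanishes at shift 0, and its norm depends only
    -- on `r`, not on the shift.
    have hshift : ∀ t, x (h + t) = ∑ j : Fin h, b j • x (j + t) := by
      intro t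
      have h1 : ∀ t, ∑ i : Fin (h + 1), (Fin.snoc b (-1) : Fin (h + 1) → ℝ) i • x (i + t) =
          ∑ j : Fin h, b j • x (j + t) - x (h + t) := by
        intro t
        rw [Fin.sum_univ_castSucc]
        simp [sub_eq_add_neg]
      have h2 := hnorm (Fin.snoc b (-1)) t
      rw [← hnorm (Fin.snoc b (-1)) 0, h1, h1] at h2
      simp only [add_zero] at h2
      rw [hb, sub_self, norm_zero] at h2
      have h3 : ‖∑ j : Fin h, b j • x (j + t) - x (h + t)‖ = 0 := by
        have : ‖∑ j : Fin h, b j • x (j + t) - x (h + t)‖ ^ 2 = 0 := by simpa using h2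
        exact pow_eq_zero_iff two_ne_zero |>.1 this
      exact (sub_eq_zero.1 (norm_eq_zero.1 h3)).symm
    have hmemW : ∀ t, x t ∈ W := by
      intro t
      induction t using Nat.strong_induction_on with
      | _ t iht =>
        rcases lt_or_ge t h with ht | ht
        · exact Submodule.subset_span ⟨⟨t, ht⟩, rfl⟩
        · obtain ⟨u, rfl⟩ := Nat.exists_eq_add_of_le ht
          rw [hshift u]
          exact Submodule.sum_mem _ fun j _ => Submodule.smul_mem _ _ (iht _ (by omega))
    have hweak : ∀ w ∈ W, Tendsto (fun t => inner ℝ w (x t)) atTop (𝓝 0) := by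
      intro w hw
      induction hw using Submodule.span_induction with
      | mem w hw =>
        obtain ⟨i, rfl⟩ := hw
        simp only [hr]
        refine hlim.comp (tendsto_atTop_mono' (f₁ := fun t : ℕ => t - (i : ℕ)) _ ?_
          (tendsto_sub_atTop_nat _))
        exact Eventually.of_forall fun t => by beta_reduce; omega
      | zero => simp
      | add u v _ _ hu hv => simpa [inner_add_left] using hu.add hv
      | smul a u _ hu => simpa [real_inner_smul_left] using hu.const_mul a
    have hfin : FiniteDimensional ℝ W := FiniteDimensional.span_of_finite ℝ (Set.finite_range _)
    set e := stdOrthonormalBasis ℝ W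
    have hsum : Tendsto (fun t => ∑ i, inner ℝ ((e i : W) : H) (x t) ^ 2) atTop (𝓝 0) := by
      have := tendsto_finsetSum Finset.univ fun i _ => (hweak (e i) (e i).2).pow 2
      simpa using this
    have hone : ∀ t, ∑ i, inner ℝ ((e i : W) : H) (x t) ^ 2 = 1 := by
      intro t
      have h1 := e.sum_sq_norm_inner_right ⟨x t, hmemW t⟩
      have h2 : ‖x t‖ ^ 2 = 1 := by
        rw [← real_inner_self_eq_norm_sq, hr]
        simpa using h0
      rw [show ‖(⟨x t, hmemW t⟩ : W)‖ = ‖x t‖ from rfl, h2] at h1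
      rw [← h1]
      refine Finset.sum_congr rfl fun i _ => ?_
      rw [Real.norm_eq_abs, sq_abs]
      rfl
    simp only [hone] at hsum
    exact one_ne_zero (tendsto_nhds_unique tendsto_const_nhds hsum)

namespace IsStationaryStandardGaussian

variable {Ω : Type*} [MeasurableSpace Ω] {P : Measure Ω} {X : ℕ → Ω → ℝ}

theorem aemeasurable (hX : IsStationaryStandardGaussian X P) (t : ℕ) : AEMeasurable (X t) P :=
  hX.gaussian.aemeasurable t

theorem memLp_two (hX : IsStationaryStandardGaussian X P) (t : ℕ) : MemLp (X t) 2 P :=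
  (hX.gaussian.hasGaussianLaw_eval t).memLp_two

theorem integral_eq_zero (hX : IsStationaryStandardGaussian X P) (t : ℕ) : ∫ ω, X t ω ∂P = 0 := by
  rw [(hX.standard t).integral_eq, integral_id_gaussianReal]

theorem variance_eq_one (hX : IsStationaryStandardGaussian X P) (t : ℕ) : Var[X t; P] = 1 := by
  rw [(hX.standard t).variance_eq, variance_id_gaussianReal]
  rfl

theorem covariance_add (hX : IsStationaryStandardGaussian X P) (k s t : ℕ) :
    cov[X (s + k), X (t + k); P] = cov[X s, X t; P] := by
  have hm : ∀ k, AEMeasurable (fun ω t => X (t + k) ω) P := fun k =>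
    aemeasurable_pi_lambda _ fun t => hX.aemeasurable _
  have h : ∀ k, cov[X (s + k), X (t + k); P] =
      cov[fun x : ℕ → ℝ => x s, fun x => x t; P.map fun ω t => X (t + k) ω] := fun k =>
    by
      rw [covariance_map (measurable_pi_apply s).aestronglyMeasurable
        (measurable_pi_apply t).aestronglyMeasurable (hm k)]
      rfl
  rw [h k, (hX.stationary k).map_eq]
  exact (h 0).symm

theorem covariance_eq (hX : IsStationaryStandardGaussian X P) (s t : ℕ) :
    cov[X s, X t; P] = cov[X 0, X ((s : ℤ) - t).natAbs; P] := by
  rcases le_total s t with h | h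
  · obtain ⟨k, rfl⟩ := Nat.exists_eq_add_of_le h
    rw [show ((s : ℤ) - (s + k : ℕ)).natAbs = k by omega, ← hX.covariance_add s 0 k]
    congr 2 <;> omega
  · obtain ⟨k, rfl⟩ := Nat.exists_eq_add_of_le h
    rw [show (((t + k : ℕ) : ℤ) - t).natAbs = k by omega, ← hX.covariance_add t 0 k,
      covariance_comm]
    congr 2 <;> omega

/-- The variables are centred, so the covariance matrix is their Gram matrix in `L²`. -/
theorem posDef_covMatrix [IsProbabilityMeasure P] (hX : IsStationaryStandardGaussian X P)
    (hlim : Tendsto (fun k => cov[X 0, X k; P]) atTop (𝓝 0)) (h : ℕ) :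
    (covMatrix X P h).PosDef := by
  set x : ℕ → Lp ℝ 2 P := fun t => (hX.memLp_two t).toLp
  have hinner : ∀ s t, inner ℝ (x s) (x t) = cov[X s, X t; P] := by
    intro s t
    rw [covariance_eq_sub (hX.memLp_two s) (hX.memLp_two t), hX.integral_eq_zero, zero_mul, sub_zero,
      MeasureTheory.L2.inner_def]
    refine integral_congr_ae ?_
    filter_upwards [(hX.memLp_two s).coeFn_toLp, (hX.memLp_two t).coeFn_toLp] with ω h1 h2
    simp only [x, h1, h2, Pi.mul_apply]
    simp [mul_comm]
  have hli := linearIndependent_of_stationary (x := x) (r := fun k => cov[X 0, X k; P])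
    (fun s t => by rw [hinner, hX.covariance_eq])
    (by rw [covariance_self (hX.aemeasurable 0), hX.variance_eq_one]) hlim h
  have hgram : covMatrix X P h = Matrix.gram ℝ fun i : Fin h => x i := by
    ext i j
    rw [Matrix.gram_apply, hinner, covMatrix, Matrix.of_apply]
  rw [hgram]
  exact Matrix.posDef_gram_of_linearIndependent hli

end IsStationaryStandardGaussian

/-! ### Windows and whitening -/

/-- The window `(X_k, …, X_{k+h-1})`. -/
def window {Ω : Type*} (h : ℕ) (X : ℕ → Ω → ℝ) (k : ℕ) (ω : Ω) : Fin h → ℝ := fun j => X (k + j) ω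

-- `A` is the symmetric square root of `S`, and `B` its inverse: `B` maps a window to a standard
-- Gaussian vector and `A` maps it back.
open scoped MatrixOrder in
theorem exists_whitening {ι : Type*} [Fintype ι] [DecidableEq ι] {S : Matrix ι ι ℝ}
    (hS : S.PosDef) : ∃ A B : Matrix ι ι ℝ, A * B = 1 ∧ B * S * B.transpose = 1 := by
  set A := CFC.sqrt S
  have hA : A * A = S := CFC.sqrt_mul_sqrt_self S hS.posSemidef.nonneg
  have hAT : A.transpose = A := by
    have := (CFC.sqrt_nonneg S).isSelfAdjoint.star_eq
    rwa [Matrix.star_eq_conjTranspose, Matrix.conjTranspose_eq_transpose_of_trivial] at this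
  have hdet : IsUnit A.det := by
    have := hS.det_pos
    rw [← hA, Matrix.det_mul] at this
    exact isUnit_iff_ne_zero.2 fun h0 => by simp [h0] at this
  refine ⟨A, A⁻¹, Matrix.mul_nonsing_inv _ hdet, ?_⟩
  rw [← hA, Matrix.transpose_nonsing_inv, hAT, ← Matrix.mul_assoc,
    Matrix.nonsing_inv_mul _ hdet, Matrix.one_mul, Matrix.mul_nonsing_inv _ hdet]

namespace IsStationaryStandardGaussian

variable {Ω : Type*} [MeasurableSpace Ω] {P : Measure Ω} {X : ℕ → Ω → ℝ}

theorem hasGaussianLaw_comp (hX : IsStationaryStandardGaussian X P) {κ : Type*} [Fintype κ]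
    (e : κ → ℕ) : HasGaussianLaw (fun ω k => X (e k) ω) P := by
  classical
  exact (hX.gaussian.hasGaussianLaw (Finset.univ.image e)).map_fun
    (ContinuousLinearMap.pi fun k => ContinuousLinearMap.proj
      (⟨e k, Finset.mem_image_of_mem e (Finset.mem_univ k)⟩ : Finset.univ.image e))

theorem covariance_sum_sum [IsProbabilityMeasure P] (hX : IsStationaryStandardGaussian X P)
    {κ κ' : Type*} [Fintype κ]
    [Fintype κ'] (a : κ → ℝ) (b : κ' → ℝ) (m : κ → ℕ) (n : κ' → ℕ) :
    cov[fun ω => ∑ p, a p * X (m p) ω, fun ω => ∑ q, b q * X (n q) ω; P] =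
      ∑ p, ∑ q, a p * b q * cov[X (m p), X (n q); P] := by
  rw [covariance_fun_sum_fun_sum (fun p => (hX.memLp_two _).const_mul _)
    fun q => (hX.memLp_two _).const_mul _]
  simp_rw [covariance_const_mul_left, covariance_const_mul_right, mul_assoc]

theorem identDistrib_window (hX : IsStationaryStandardGaussian X P) (h k : ℕ) :
    IdentDistrib (window h X k) (window h X 0) P P := by
  have := (hX.stationary k).comp (u := fun (x : ℕ → ℝ) (j : Fin h) => x j) (by fun_prop)
  convert this using 1
  · ext ω j; simp [window, add_comm]
  · ext ω j; simp [window]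

theorem identDistrib_window_pair (hX : IsStationaryStandardGaussian X P) (h i k : ℕ) :
    IdentDistrib (fun ω => (window h X i ω, window h X (i + k) ω))
      (fun ω => (window h X 0 ω, window h X k ω)) P P := by
  have := (hX.stationary i).comp
    (u := fun (x : ℕ → ℝ) => ((fun j : Fin h => x j), fun j : Fin h => x (k + j))) (by fun_prop)
  convert this using 1
  · ext ω j
    · simp [window, add_comm]
    · simp only [window, Function.comp]; congr 1; omega
  · ext ω j <;> simp [window]

/-- A function of a window which is orthogonal to the affine functions of the window has
autocovariances of second order in the autocovariances of the process. -/
theorem exists_abs_integral_mul_le [IsProbabilityMeasure P] (hX : IsStationaryStandardGaussian X P)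
    {h : ℕ} (hS : (covMatrix X P h).PosDef) {g : (Fin h → ℝ) → ℝ} (hgm : Measurable g)
    (hg : MemLp (fun ω => g (window h X 0 ω)) 2 P) (hg0 : ∫ ω, g (window h X 0 ω) ∂P = 0)
    (hg1 : ∀ i : Fin h, ∫ ω, g (window h X 0 ω) * X i ω ∂P = 0) :
    ∃ C ε₀ : ℝ, 0 < ε₀ ∧ ∀ (k : ℕ) (ε : ℝ), 0 < ε → ε ≤ ε₀ →
      (∀ i j : Fin h, |cov[X i, X (k + j); P]| ≤ ε) →
      |∫ ω, g (window h X 0 ω) * g (window h X k ω) ∂P| ≤ C * ε ^ 2 := by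
  obtain ⟨A, B, hAB, hB⟩ := exists_whitening hS
  set β : ℝ := ∑ i, ∑ p, |B i p| with hβ
  -- Whitened cross-covariances are at most `β² ε`; multiplied by the dimension `h` they stay below
  -- `κ ε`, which serves as `s ^ 2`. The `+ 1` keeps `κ` positive.
  set κ : ℝ := β * β * h + 1 with hκ
  have hβ0 : 0 ≤ β := Finset.sum_nonneg fun i _ => Finset.sum_nonneg fun p _ => abs_nonneg _
  have hκ0 : 0 < κ := by positivity
  set g' : (Fin h → ℝ) → ℝ := fun y => g (A.mulVec y) with hg'
  have hg'm : Measurable g' := hgm.comp (by fun_prop)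
  have hgB : ∀ y, g' (B.mulVec y) = g y := fun y => by
    simp only [hg', Matrix.mulVec_mulVec, hAB, Matrix.one_mulVec]
  have hcovB : ∀ k (i j : Fin h), cov[fun ω => B.mulVec (window h X k ω) i,
      fun ω => B.mulVec (window h X k ω) j; P] = if i = j then 1 else 0 := by
    intro k i j
    have h1 := hX.covariance_sum_sum (fun p => B i p) (fun q => B j q)
      (fun p : Fin h => k + p) (fun q : Fin h => k + q)
    refine h1.trans ?_
    have h2 : (B * covMatrix X P h * B.transpose) i j = if i = j then 1 else 0 := by
      rw [hB, Matrix.one_apply]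
    rw [← h2, Matrix.mul_apply, Finset.sum_comm]
    refine Finset.sum_congr rfl fun q _ => ?_
    rw [Matrix.mul_apply, Finset.sum_mul]
    refine Finset.sum_congr rfl fun p _ => ?_
    rw [Matrix.transpose_apply, covMatrix, Matrix.of_apply, add_comm k, add_comm k,
      hX.covariance_add]
    ring
  have hmeanB : ∀ k (i : Fin h), ∫ ω, B.mulVec (window h X k ω) i ∂P = 0 := by
    intro k i
    simp only [Matrix.mulVec, dotProduct, window]
    rw [integral_finsetSum _ fun p _ => ((hX.memLp_two _).integrable one_le_two).const_mul _]
    simp [integral_const_mul, hX.integral_eq_zero]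
  have hG : HasGaussianLaw (fun ω => B.mulVec (window h X 0 ω)) P :=
    (hX.hasGaussianLaw_comp fun j : Fin h => 0 + (j : ℕ)).map_fun
      (LinearMap.toContinuousLinearMap B.mulVecLin)
  have hlaw : P.map (fun ω => B.mulVec (window h X 0 ω)) = stdPi (Fin h) := by
    rw [map_eq_of_hasGaussianLaw hG (hasGaussianLaw_id_stdPi _)
      (fun k => by rw [hmeanB, integral_eval, integral_id_gaussianReal])
      (fun k l => by rw [hcovB, covariance_eval_stdPi]), Measure.map_id']
  have hint : ∀ f : (Fin h → ℝ) → ℝ, Measurable f →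
      ∫ y, f y ∂(stdPi (Fin h)) = ∫ ω, f (B.mulVec (window h X 0 ω)) ∂P := fun f hf => by
    rw [← hlaw, integral_map hG.aemeasurable hf.aestronglyMeasurable]
  have hg'L : MemLp g' 2 (stdPi (Fin h)) := by
    rw [← hlaw, memLp_map_measure_iff hg'm.aestronglyMeasurable hG.aemeasurable]
    simpa only [Function.comp_def, hgB] using hg
  have hg'0 : ∫ y, g' y ∂(stdPi (Fin h)) = 0 := by
    rw [hint _ hg'm]; simpa only [hgB] using hg0
  have hg'1 : ∀ i, ∫ y, g' y * y i ∂(stdPi (Fin h)) = 0 := by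
    intro i
    rw [hint (fun y => g' y * y i) (hg'm.mul (measurable_pi_apply i))]
    simp only [hgB]
    have : ∀ ω, g (window h X 0 ω) * B.mulVec (window h X 0 ω) i =
        ∑ p, B i p * (g (window h X 0 ω) * X p ω) := fun ω => by
      simp only [Matrix.mulVec, dotProduct, window, Finset.mul_sum, zero_add]
      exact Finset.sum_congr rfl fun p _ => by ring
    simp only [this]
    have hi : ∀ p : Fin h, Integrable (fun ω => g (window h X 0 ω) * X p ω) P := fun p =>
      hg.integrable_mul (hX.memLp_two _)
    rw [integral_finsetSum _ fun p _ => (hi p).const_mul _]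
    simp [integral_const_mul, hg1]
  -- The threshold `1 / (2 κ)` ensures `s ^ 2 = κ ε ≤ 1 / 2`, as `inv_pow_sub_le` requires.
  refine ⟨(∫ y, g' y ^ 2 ∂(stdPi (Fin h))) * (4 ^ h * κ ^ 2), 1 / (2 * κ), by positivity,
    fun k ε hε hε0 hcross => ?_⟩
  have ht0 : 0 < κ * ε := by positivity
  have ht : κ * ε ≤ 1 / 2 := by
    rw [le_div_iff₀ (by positivity)] at hε0
    linarith
  have hs2 : √(κ * ε) ^ 2 = κ * ε := Real.sq_sqrt ht0.le
  have hs : √(κ * ε) ∈ Set.Ioo (0 : ℝ) 1 :=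
    ⟨Real.sqrt_pos.2 ht0, by rw [Real.sqrt_lt' one_pos]; linarith⟩
  set Z : Ω → Fin h ⊕ Fin h → ℝ := fun ω =>
    Sum.elim (B.mulVec (window h X 0 ω)) (B.mulVec (window h X k ω)) with hZdef
  have hZ : HasGaussianLaw Z P := by
    let T : (Fin h ⊕ Fin h → ℝ) →L[ℝ] (Fin h ⊕ Fin h → ℝ) :=
      LinearMap.toContinuousLinearMap (Matrix.fromBlocks B 0 0 B).mulVecLin
    have := (hX.hasGaussianLaw_comp
      (Sum.elim (fun j : Fin h => 0 + (j : ℕ)) fun j : Fin h => k + (j : ℕ))).map_fun T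
    have hZT : Z = fun ω => T fun l => X (Sum.elim (fun j : Fin h => 0 + (j : ℕ))
        (fun j : Fin h => k + (j : ℕ)) l) ω := by
      funext ω
      simp only [T, LinearMap.coe_toContinuousLinearMap', Matrix.mulVecLin_apply,
        Matrix.fromBlocks_mulVec, Matrix.zero_mulVec, add_zero, zero_add, hZdef]
      congr 2
      ext j
      simp [window]
    rw [hZT]
    exact this
  have hbound := abs_integral_mul_le_of_hasGaussianLaw hZ
    (by rintro (i | i)
        · exact hmeanB 0 i
        · exact hmeanB k i)
    (hcovB 0) (hcovB k) hs (fun i j => by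
      have h1 := hX.covariance_sum_sum (fun p => B i p) (fun q => B j q)
        (fun p : Fin h => 0 + p) (fun q : Fin h => k + q)
      have h2 : cov[fun ω => Z ω (.inl i), fun ω => Z ω (.inr j); P] =
        ∑ p, ∑ q, B i p * B j q * cov[X (0 + (p : ℕ)), X (k + q); P] := h1
      have h3 : ∀ i, ∑ p, |B i p| ≤ β := fun i =>
        Finset.single_le_sum (f := fun i => ∑ p, |B i p|)
          (fun i _ => Finset.sum_nonneg fun p _ => abs_nonneg _) (Finset.mem_univ i)
      have h4 : |∑ p, ∑ q, B i p * B j q * cov[X (0 + (p : ℕ)), X (k + q); P]| ≤ β * β * ε := by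
        calc _ ≤ ∑ p, ∑ q, |B i p| * |B j q| * ε := by
              refine (Finset.abs_sum_le_sum_abs _ _).trans (Finset.sum_le_sum fun p _ => ?_)
              refine (Finset.abs_sum_le_sum_abs _ _).trans (Finset.sum_le_sum fun q _ => ?_)
              rw [abs_mul, abs_mul, zero_add]
              gcongr
              exact hcross p q
          _ = (∑ p, |B i p|) * (∑ q, |B j q|) * ε := by
              rw [Finset.sum_mul_sum, Finset.sum_mul]
              simp_rw [Finset.sum_mul]
          _ ≤ β * β * ε := by
              gcongr
              · exact h3 i
              · exact h3 j
      rw [h2, hs2, Fintype.card_fin]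
      calc _ ≤ β * β * ε * h := by gcongr
        _ ≤ κ * ε := by rw [hκ]; nlinarith)
    hg'm hg'L hg'0 hg'1
  simp only [hZdef, Sum.elim_inl, Sum.elim_inr, hs2, Fintype.card_fin] at hbound
  have heq : ∫ ω, g' (fun i => B.mulVec (window h X 0 ω) i) *
      g' (fun i => B.mulVec (window h X k ω) i) ∂P =
      ∫ ω, g (window h X 0 ω) * g (window h X k ω) ∂P := by
    refine integral_congr_ae (Eventually.of_forall fun ω => ?_)
    exact congrArg₂ (· * ·) (hgB _) (hgB _)
  rw [heq] at hbound
  refine hbound.trans ?_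
  calc _ ≤ (∫ y, g' y ^ 2 ∂(stdPi (Fin h))) * (4 ^ h * (κ * ε) ^ 2) :=
        mul_le_mul_of_nonneg_left (inv_pow_sub_le ht0.le ht) (integral_nonneg fun _ => sq_nonneg _)
    _ = _ := by ring

end IsStationaryStandardGaussian

/-! ### Negligibility of functionals of Hermite rank at least two -/

namespace RegularlyVarying

variable {r : ℕ → ℝ} {D : ℝ}

theorem tendsto_div_add (hr : RegularlyVarying r D) (d : ℕ) :
    Tendsto (fun k => r k / r (k + d)) atTop (𝓝 1) := by
  have h := hr.tendsto_div (a := fun k => k) (b := fun k => k + d) tendsto_id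
    (Eventually.of_forall fun k => Nat.le_add_right k d) one_pos (by
      have h1 : Tendsto (fun k : ℕ => 1 + (d : ℝ) / k) atTop (𝓝 (1 + 0)) :=
        (tendsto_const_div_atTop_nhds_zero_nat (d : ℝ)).const_add 1
      rw [add_zero] at h1
      refine h1.congr' ?_
      filter_upwards [eventually_gt_atTop 0] with k hk
      have : (k : ℝ) ≠ 0 := by positivity
      push_cast
      field_simp)
  rwa [Real.one_rpow] at h

/-- Needed because the covariance of `X i` and `X (k + j)` is `r (k - i + j)`; the truncated
subtraction is genuine once `k ≥ i`. -/
theorem isBigO_shift (hr : RegularlyVarying r D) (i j : ℕ) :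
    (fun k => r (k - i + j)) =O[atTop] r := by
  obtain ⟨N, hN⟩ := eventually_atTop.1 hr.eventually_pos
  have h1 : (fun k => r (k + j)) =O[atTop] r := by
    have := (hr.tendsto_div_add j).inv₀ one_ne_zero
    refine Asymptotics.isBigO_of_div_tendsto_nhds ?_ _ (this.congr fun k => by simp)
    filter_upwards [eventually_ge_atTop N] with k hk h0
    exact absurd h0 (hN k hk).ne'
  have h2 : r =O[atTop] fun k => r (k + i) := by
    refine Asymptotics.isBigO_of_div_tendsto_nhds ?_ _ (hr.tendsto_div_add i)
    filter_upwards [eventually_ge_atTop N] with k hk h0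
    exact absurd h0 (hN _ (hk.trans (Nat.le_add_right _ _))).ne'
  refine ((h1.trans h2).comp_tendsto (tendsto_sub_atTop_nat i)).trans_eventuallyEq ?_
  filter_upwards [eventually_ge_atTop i] with k hk
  simp only [Function.comp]
  rw [Nat.sub_add_cancel hk]

end RegularlyVarying

namespace IsStationaryStandardGaussian

variable {Ω : Type*} [MeasurableSpace Ω] {P : Measure Ω} {X : ℕ → Ω → ℝ}

theorem aemeasurable_window (hX : IsStationaryStandardGaussian X P) (h k : ℕ) :
    AEMeasurable (window h X k) P :=
  aemeasurable_pi_lambda _ fun _ => hX.aemeasurable _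

theorem memLp_comp_window (hX : IsStationaryStandardGaussian X P) {h : ℕ} {g : (Fin h → ℝ) → ℝ}
    (hgm : Measurable g) (hg : MemLp (fun ω => g (window h X 0 ω)) 2 P) (k : ℕ) :
    MemLp (fun ω => g (window h X k ω)) 2 P :=
  ((hX.identDistrib_window h k).comp hgm).memLp_iff.2 hg

theorem integral_mul_window (hX : IsStationaryStandardGaussian X P) {h : ℕ} {g : (Fin h → ℝ) → ℝ}
    (hgm : Measurable g) (i j : ℕ) :
    ∫ ω, g (window h X i ω) * g (window h X j ω) ∂P =
      ∫ ω, g (window h X 0 ω) * g (window h X ((i : ℤ) - j).natAbs ω) ∂P := by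
  have key : ∀ i k, ∫ ω, g (window h X i ω) * g (window h X (i + k) ω) ∂P =
      ∫ ω, g (window h X 0 ω) * g (window h X k ω) ∂P := fun i k =>
    ((hX.identDistrib_window_pair h i k).comp (u := fun p : (Fin h → ℝ) × (Fin h → ℝ) => g p.1 * g p.2)
      (by fun_prop)).integral_eq
  rcases le_total i j with hij | hij
  · obtain ⟨k, rfl⟩ := Nat.exists_eq_add_of_le hij
    rw [key, show ((i : ℤ) - (i + k : ℕ)).natAbs = k by omega]
  · obtain ⟨k, rfl⟩ := Nat.exists_eq_add_of_le hij
    rw [show (((j + k : ℕ) : ℤ) - j).natAbs = k by omega, ← key j k]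
    simp only [mul_comm]

/-- The covariance is quadratic in quantities that are `O(r k)`, and `r k → 0` absorbs one factor.
-/
theorem integral_mul_window_isLittleO [IsProbabilityMeasure P]
    (hX : IsStationaryStandardGaussian X P) {D : ℝ} (hD0 : 0 < D)
    (hr : RegularlyVarying (fun k => cov[X 0, X k; P]) D)
    {h : ℕ} (hS : (covMatrix X P h).PosDef) {g : (Fin h → ℝ) → ℝ} (hgm : Measurable g)
    (hg : MemLp (fun ω => g (window h X 0 ω)) 2 P) (hg0 : ∫ ω, g (window h X 0 ω) ∂P = 0)
    (hg1 : ∀ i : Fin h, ∫ ω, g (window h X 0 ω) * X i ω ∂P = 0) :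
    (fun k => ∫ ω, g (window h X 0 ω) * g (window h X k ω) ∂P) =o[atTop]
      fun k => cov[X 0, X k; P] := by
  obtain ⟨C, ε₀, hε₀, hC⟩ := hX.exists_abs_integral_mul_le hS hgm hg hg0 hg1
  set r : ℕ → ℝ := fun k => cov[X 0, X k; P]
  -- The summand `|r k|` makes `e k` eventually strictly positive, even for `h = 0`.
  set e : ℕ → ℝ := fun k => ∑ i : Fin h, ∑ j : Fin h, |cov[X i, X (k + j); P]| + |r k|
  have hcov : ∀ i j : Fin h, (fun k => |cov[X i, X (k + j); P]|) =O[atTop] r := by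
    intro i j
    refine ((hr.isBigO_shift i j).abs_left).congr' ?_ EventuallyEq.rfl
    filter_upwards [eventually_ge_atTop (i : ℕ)] with k hk
    rw [hX.covariance_eq]
    congr 3
    omega
  have heO : e =O[atTop] r :=
    (Asymptotics.IsBigO.fun_sum fun i _ => Asymptotics.IsBigO.fun_sum fun j _ => hcov i j).add
      (Asymptotics.isBigO_refl r atTop).abs_left
  have hr0 : Tendsto r atTop (𝓝 0) := hr.tendsto_zero hD0
  have he0 : Tendsto e atTop (𝓝 0) := heO.trans_tendsto hr0
  have hle : (fun k => ∫ ω, g (window h X 0 ω) * g (window h X k ω) ∂P) =O[atTop]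
      fun k => e k * e k := by
    refine Asymptotics.IsBigO.of_bound C ?_
    filter_upwards [he0.eventually_le_const hε₀, hr.eventually_pos] with k hk hrk
    have hs : 0 ≤ ∑ i : Fin h, ∑ j : Fin h, |cov[X i, X (k + j); P]| :=
      Finset.sum_nonneg fun _ _ => Finset.sum_nonneg fun _ _ => abs_nonneg _
    have hpos : 0 < e k := add_pos_of_nonneg_of_pos hs (abs_pos.2 hrk.ne')
    have := hC k (e k) hpos hk fun i j => by
      calc |cov[X i, X (k + j); P]| ≤ ∑ j : Fin h, |cov[X i, X (k + j); P]| :=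
            Finset.single_le_sum (f := fun j : Fin h => |cov[X i, X (k + j); P]|)
              (fun _ _ => abs_nonneg _) (Finset.mem_univ j)
        _ ≤ ∑ i : Fin h, ∑ j : Fin h, |cov[X i, X (k + j); P]| :=
            Finset.single_le_sum (f := fun i : Fin h => ∑ j : Fin h, |cov[X i, X (k + j); P]|)
              (fun _ _ => Finset.sum_nonneg fun _ _ => abs_nonneg _) (Finset.mem_univ i)
        _ ≤ e k := le_add_of_nonneg_right (abs_nonneg _)
    rw [Real.norm_eq_abs, Real.norm_of_nonneg (by positivity), ← sq]
    exact this
  refine hle.trans_isLittleO ?_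
  have h1 : e =o[atTop] (1 : ℕ → ℝ) := (Asymptotics.isLittleO_one_iff ℝ).2 he0
  simpa using h1.mul_isBigO heO

/-- Partial sums of a functional of Hermite rank at least two are negligible in `L²` with respect
to the partial sums of the process. -/
theorem tendsto_integral_sq_sum_div [IsProbabilityMeasure P]
    (hX : IsStationaryStandardGaussian X P) {D : ℝ} (hD0 : 0 < D) (hD1 : D < 1)
    (hr : RegularlyVarying (fun k => cov[X 0, X k; P]) D)
    {h : ℕ} (hS : (covMatrix X P h).PosDef) {g : (Fin h → ℝ) → ℝ} (hgm : Measurable g)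
    (hg : MemLp (fun ω => g (window h X 0 ω)) 2 P) (hg0 : ∫ ω, g (window h X 0 ω) ∂P = 0)
    (hg1 : ∀ i : Fin h, ∫ ω, g (window h X 0 ω) * X i ω ∂P = 0) :
    Tendsto (fun n : ℕ => (∫ ω, (∑ i ∈ Finset.range n, g (window h X i ω)) ^ 2 ∂P) /
      ((n : ℝ) ^ 2 * cov[X 0, X n; P])) atTop (𝓝 0) := by
  refine (hr.tendsto_sum_sum_div_of_isLittleO hD0 hD1
    (hX.integral_mul_window_isLittleO hD0 hr hS hgm hg hg0 hg1)).congr fun n => ?_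
  congr 1
  simp_rw [sq, Finset.sum_mul_sum]
  have hi : ∀ i j, Integrable (fun ω => g (window h X i ω) * g (window h X j ω)) P := fun i j =>
    (hX.memLp_comp_window hgm hg i).integrable_mul (hX.memLp_comp_window hgm hg j)
  rw [integral_finsetSum _ fun i _ => integrable_finsetSum _ fun j _ => hi i j]
  refine Finset.sum_congr rfl fun i _ => ?_
  rw [integral_finsetSum _ fun j _ => hi i j]
  exact Finset.sum_congr rfl fun j _ => (hX.integral_mul_window hgm i j).symm

/-- The variance of the partial sums of the process. -/
theorem tendsto_variance_sum_div [IsProbabilityMeasure P]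
    (hX : IsStationaryStandardGaussian X P) {D : ℝ} (hD0 : 0 < D) (hD1 : D < 1)
    (hr : RegularlyVarying (fun k => cov[X 0, X k; P]) D) :
    Tendsto (fun n : ℕ => Var[fun ω => ∑ i ∈ Finset.range n, X i ω; P] /
      ((n : ℝ) ^ 2 * cov[X 0, X n; P])) atTop (𝓝 (2 / ((1 - D) * (2 - D)))) := by
  refine (hr.tendsto_sum_sum_div hD0 hD1).congr fun n => ?_
  congr 1
  rw [variance_fun_sum' fun i _ => hX.memLp_two i]
  exact Finset.sum_congr rfl fun i _ => Finset.sum_congr rfl fun j _ => (hX.covariance_eq i j).symm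

end IsStationaryStandardGaussian

/-! ### Convergence in distribution -/

section Convergence

open scoped NNReal

variable {Ω : Type*} [MeasurableSpace Ω] {P : Measure Ω}

/-- All the laws are realised on one space as `√v z` with a single standard normal `z`, where
convergence is pointwise. The degenerate limit `v₀ = 0` needs no separate case. -/
theorem tendstoInDistribution_of_map_eq_gaussianReal [IsProbabilityMeasure P] {X : ℕ → Ω → ℝ} {v : ℕ → ℝ≥0}
    {v₀ : ℝ≥0} (hm : ∀ n, AEMeasurable (X n) P) (hX : ∀ n, P.map (X n) = gaussianReal 0 (v n))
    (hv : Tendsto v atTop (𝓝 v₀)) :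
    TendstoInDistribution X atTop (id : ℝ → ℝ) (fun _ => P) (gaussianReal 0 v₀) := by
  have hmap : ∀ w : ℝ≥0, (gaussianReal 0 1).map (fun z : ℝ => (NNReal.sqrt w : ℝ) * z) =
      gaussianReal 0 w := fun w => by
    rw [gaussianReal_map_const_mul, mul_zero, mul_one]
    congr 1
    ext
    simp
  have h := tendstoInDistribution_of_ae_tendsto (μ' := gaussianReal 0 1) (l := atTop)
    (X := fun n z => (NNReal.sqrt (v n) : ℝ) * z) (Z := fun z => (NNReal.sqrt v₀ : ℝ) * z)
    (fun n => by fun_prop) (by fun_prop) (Eventually.of_forall fun z =>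
      ((NNReal.tendsto_coe.2 ((NNReal.continuous_sqrt.tendsto v₀).comp hv)).mul_const z))
  refine ⟨hm, aemeasurable_id, ?_⟩
  have hlim : (⟨(gaussianReal 0 v₀).map id, Measure.isProbabilityMeasure_map aemeasurable_id⟩ :
      ProbabilityMeasure ℝ) = ⟨_, Measure.isProbabilityMeasure_map h.aemeasurable_limit⟩ :=
    Subtype.ext (Measure.map_id.trans (hmap v₀).symm)
  rw [hlim]
  exact h.tendsto.congr fun n => Subtype.ext ((hmap (v n)).trans (hX n).symm)

theorem tendstoInMeasure_zero_of_integral_sq {Z : ℕ → Ω → ℝ} (hZ : ∀ n, MemLp (Z n) 2 P)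
    (h : Tendsto (fun n => ∫ ω, Z n ω ^ 2 ∂P) atTop (𝓝 0)) : TendstoInMeasure P Z atTop 0 := by
  refine tendstoInMeasure_of_tendsto_eLpNorm (p := 2) two_ne_zero
    (fun n => (hZ n).aestronglyMeasurable) aestronglyMeasurable_zero ?_
  have h1 : ∀ n, eLpNorm (Z n - 0) 2 P = ENNReal.ofReal (√(∫ ω, Z n ω ^ 2 ∂P)) := fun n => by
    rw [sub_zero, (hZ n).eLpNorm_eq_integral_rpow_norm two_ne_zero ENNReal.ofNat_ne_top,
      Real.sqrt_eq_rpow]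
    simp
  simp_rw [h1]
  have h2 := (Real.continuous_sqrt.tendsto 0).comp h
  rw [Real.sqrt_zero] at h2
  simpa using ENNReal.tendsto_ofReal h2

end Convergence

namespace IsStationaryStandardGaussian

variable {Ω : Type*} [MeasurableSpace Ω] {P : Measure Ω} {X : ℕ → Ω → ℝ}

theorem integral_sq (hX : IsStationaryStandardGaussian X P) (t : ℕ) : ∫ ω, X t ω ^ 2 ∂P = 1 := by
  rw [← variance_of_integral_eq_zero (hX.aemeasurable t) (hX.integral_eq_zero t),
    hX.variance_eq_one]

/-- Sums of linear functionals of the windows agree with multiples of the partial sums up to a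
remainder which is bounded in `L²`. -/
theorem integral_sq_sum_window_sub_le (hX : IsStationaryStandardGaussian X P) {h : ℕ}
    (α : Fin h → ℝ) (n : ℕ) :
    ∫ ω, (∑ i ∈ Finset.range n, ∑ j, α j * window h X i ω j -
      (∑ j, α j) * ∑ i ∈ Finset.range n, X i ω) ^ 2 ∂P ≤ (∑ j, α j ^ 2) * (4 * h ^ 3) := by
  set d : Ω → ℝ := fun ω => ∑ i ∈ Finset.range h, (X (n + i) ω ^ 2 + X i ω ^ 2) with hd
  have hi : ∀ t, Integrable (fun ω => X t ω ^ 2) P := fun t => (hX.memLp_two t).integrable_sq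
  have hdi : Integrable d P := integrable_finsetSum _ fun i _ => (hi _).add (hi _)
  have hdint : ∫ ω, d ω ∂P = 2 * h := by
    have hi2 : ∀ i, Integrable (fun ω => X (n + i) ω ^ 2 + X i ω ^ 2) P := fun i =>
      (hi _).add (hi _)
    simp only [hd]
    rw [integral_finsetSum _ fun i _ => hi2 i, Finset.sum_congr rfl fun i _ => integral_add (hi (n + i)) (hi i)]
    simp only [hX.integral_sq, Finset.sum_const, Finset.card_range, nsmul_eq_mul]
    ring
  have hu : ∀ (j : Fin h) ω, (∑ i ∈ Finset.range n, X (i + j) ω - ∑ i ∈ Finset.range n, X i ω) ^ 2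
      ≤ 2 * h * d ω := by
    intro j ω
    -- Shifting the summation range by `j` changes only `j` terms at each end, so the error does not
    -- grow with `n`.
    have e1 : ∑ i ∈ Finset.range n, X (i + j) ω - ∑ i ∈ Finset.range n, X i ω =
        ∑ i ∈ Finset.range j, (X (n + i) ω - X i ω) := by
      have a1 := Finset.sum_range_add (fun i => X i ω) n j
      have a2 := Finset.sum_range_add (fun i => X i ω) j n
      rw [add_comm (j : ℕ) n, a1] at a2
      rw [Finset.sum_sub_distrib]
      simp only [add_comm _ (j : ℕ)]
      linarith
    rw [e1]
    calc _ ≤ ((Finset.range j).card : ℝ) * ∑ i ∈ Finset.range j, (X (n + i) ω - X i ω) ^ 2 :=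
          sq_sum_le_card_mul_sum_sq
      _ ≤ h * ∑ i ∈ Finset.range j, 2 * (X (n + i) ω ^ 2 + X i ω ^ 2) := by
          rw [Finset.card_range]
          gcongr with i _
          · exact j.2.le
          · nlinarith [sq_nonneg (X (n + i) ω + X i ω)]
      _ ≤ h * ∑ i ∈ Finset.range h, 2 * (X (n + i) ω ^ 2 + X i ω ^ 2) := by
          refine mul_le_mul_of_nonneg_left ?_ (by positivity)
          exact Finset.sum_le_sum_of_subset_of_nonneg (Finset.range_subset_range.2 j.2.le)
            fun i _ _ => by positivity
      _ = 2 * h * d ω := by rw [hd, ← Finset.mul_sum]; ring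
  have hpt : ∀ ω, (∑ i ∈ Finset.range n, ∑ j, α j * window h X i ω j -
      (∑ j, α j) * ∑ i ∈ Finset.range n, X i ω) ^ 2 ≤ (∑ j, α j ^ 2) * (2 * h ^ 2) * d ω := by
    intro ω
    have e2 : ∑ i ∈ Finset.range n, ∑ j, α j * window h X i ω j -
        (∑ j, α j) * ∑ i ∈ Finset.range n, X i ω =
        ∑ j : Fin h, α j *
          (∑ i ∈ Finset.range n, X (i + j) ω - ∑ i ∈ Finset.range n, X i ω) := by
      rw [Finset.sum_comm, Finset.sum_mul, ← Finset.sum_sub_distrib]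
      refine Finset.sum_congr rfl fun j _ => ?_
      rw [mul_sub, Finset.mul_sum, Finset.mul_sum]
      rfl
    rw [e2]
    calc _ ≤ (∑ j, α j ^ 2) * ∑ j : Fin h,
          (∑ i ∈ Finset.range n, X (i + j) ω - ∑ i ∈ Finset.range n, X i ω) ^ 2 :=
          Finset.sum_mul_sq_le_sq_mul_sq _ _ _
      _ ≤ (∑ j, α j ^ 2) * ∑ _j : Fin h, 2 * h * d ω := by
          gcongr with j _
          · exact hu j ω
      _ = _ := by
          rw [Finset.sum_const, Finset.card_univ, Fintype.card_fin, nsmul_eq_mul]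
          ring
  calc _ ≤ ∫ ω, (∑ j, α j ^ 2) * (2 * h ^ 2) * d ω ∂P :=
        integral_mono_of_nonneg (Eventually.of_forall fun _ => sq_nonneg _) (hdi.const_mul _)
          (Eventually.of_forall hpt)
    _ = _ := by rw [integral_const_mul, hdint]; ring

/-- A non-central limit theorem of Hermite rank one: if `f - p - ∑ αⱼ xⱼ` is orthogonal to the
affine functions of a window, then the normalised sums of `f - p` over the windows are
asymptotically normal. -/
theorem tendstoInDistribution_sum_window [IsProbabilityMeasure P]
    (hX : IsStationaryStandardGaussian X P) {D : ℝ} (hD0 : 0 < D) (hD1 : D < 1)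
    (hr : RegularlyVarying (fun k => cov[X 0, X k; P]) D)
    {h : ℕ} {f : (Fin h → ℝ) → ℝ} (hfm : Measurable f)
    (hf : MemLp (fun ω => f (window h X 0 ω)) 2 P) {p : ℝ}
    (hf0 : ∫ ω, f (window h X 0 ω) ∂P = p) {α : Fin h → ℝ}
    (hf1 : ∀ i, (covMatrix X P h).mulVec α i = ∫ ω, f (window h X 0 ω) * X i ω ∂P)
    {b : ℕ → ℝ} (hb : ∀ᶠ n : ℕ in atTop, b n ^ 2 = 1 / ((n : ℝ) ^ 2 * cov[X 0, X n; P])) :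
    TendstoInDistribution (fun (n : ℕ) ω => b n * ∑ i ∈ Finset.range n, (f (window h X i ω) - p))
      atTop (id : ℝ → ℝ) (fun _ => P)
      (gaussianReal 0 (Real.toNNReal (2 / ((1 - D) * (2 - D)) * (∑ j, α j) ^ 2))) := by
  set S : ℕ → Ω → ℝ := fun n ω => ∑ i ∈ Finset.range n, X i ω with hSdef
  -- `g` is the residual of the linear projection and `G` its partial sum; `E` is the boundary
  -- error. The centred sum of `f` is `(∑ αⱼ) S + E + G`.
  set g : (Fin h → ℝ) → ℝ := fun x => f x - p - ∑ j, α j * x j with hgdef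
  set E : ℕ → Ω → ℝ := fun n ω => ∑ i ∈ Finset.range n, ∑ j, α j * window h X i ω j -
      (∑ j, α j) * S n ω with hEdef
  set G : ℕ → Ω → ℝ := fun n ω => ∑ i ∈ Finset.range n, g (window h X i ω) with hGdef
  have hgm : Measurable g := by fun_prop
  have hlin : ∀ k, MemLp (fun ω => ∑ j, α j * window h X k ω j) 2 P := fun k =>
    memLp_finsetSum _ fun j _ => (hX.memLp_two _).const_mul _
  have hgL : MemLp (fun ω => g (window h X 0 ω)) 2 P := (hf.sub (memLp_const p)).sub (hlin 0)
  have hlini : ∀ j : Fin h, Integrable (fun ω => α j * window h X 0 ω j) P := fun j =>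
    ((hX.memLp_two _).integrable one_le_two).const_mul _
  have hg0 : ∫ ω, g (window h X 0 ω) ∂P = 0 := by
    have e1 : Integrable (fun ω => f (window h X 0 ω) - p) P :=
      (hf.integrable one_le_two).sub (integrable_const p)
    have e2 : Integrable (fun ω => ∑ j, α j * window h X 0 ω j) P :=
      (hlin 0).integrable one_le_two
    simp only [hgdef]
    rw [integral_sub e1 e2, integral_sub (hf.integrable one_le_two) (integrable_const p), hf0,
      integral_finsetSum _ fun j _ => hlini j]
    simp [integral_const_mul, window, hX.integral_eq_zero]
  -- This is where the normal equations `hf1` enter; the constant `p` drops out because the process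
  -- is centred.
  have hg1 : ∀ i : Fin h, ∫ ω, g (window h X 0 ω) * X i ω ∂P = 0 := by
    intro i
    have e1 : Integrable (fun ω => f (window h X 0 ω) * X i ω) P :=
      hf.integrable_mul (hX.memLp_two i)
    have e2 : Integrable (fun ω => p * X i ω) P :=
      ((hX.memLp_two i).integrable one_le_two).const_mul p
    have e3 : ∀ j : Fin h, Integrable (fun ω => α j * (X j ω * X i ω)) P := fun j =>
      ((hX.memLp_two j).integrable_mul (hX.memLp_two i)).const_mul _
    have e4 : Integrable (fun ω => ∑ j : Fin h, α j * (X j ω * X i ω)) P :=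
      integrable_finsetSum _ fun j _ => e3 j
    have e5 : Integrable (fun ω => f (window h X 0 ω) * X i ω - p * X i ω) P := e1.sub e2
    have e6 : ∀ ω, g (window h X 0 ω) * X i ω = f (window h X 0 ω) * X i ω - p * X i ω -
        ∑ j : Fin h, α j * (X j ω * X i ω) := fun ω => by
      simp only [hgdef, sub_mul, Finset.sum_mul, window, zero_add, mul_assoc]
    simp_rw [e6]
    rw [integral_sub e5 e4, integral_sub e1 e2, integral_finsetSum _ fun j _ => e3 j, ← hf1,
      integral_const_mul, hX.integral_eq_zero, mul_zero, sub_zero, Matrix.mulVec, dotProduct,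
      ← Finset.sum_sub_distrib]
    refine Finset.sum_eq_zero fun j _ => ?_
    rw [covMatrix, Matrix.of_apply, covariance_comm,
      covariance_eq_sub (hX.memLp_two j) (hX.memLp_two i), hX.integral_eq_zero, zero_mul, sub_zero,
      integral_const_mul]
    simp only [Pi.mul_apply]
    ring
  have hPD := hX.posDef_covMatrix (hr.tendsto_zero hD0) h
  have hSL : ∀ n, MemLp (S n) 2 P := fun n => memLp_finsetSum _ fun i _ => hX.memLp_two i
  have hEL : ∀ n, MemLp (E n) 2 P := fun n =>
    (memLp_finsetSum _ fun i _ => hlin i).sub ((hSL n).const_mul _)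
  have hGL : ∀ n, MemLp (G n) 2 P := fun n =>
    memLp_finsetSum _ fun i _ => hX.memLp_comp_window hgm hgL i
  have hmain : TendstoInDistribution (fun n ω => b n * (∑ j, α j) * S n ω) atTop (id : ℝ → ℝ)
      (fun _ => P)
      (gaussianReal 0 (Real.toNNReal (2 / ((1 - D) * (2 - D)) * (∑ j, α j) ^ 2))) := by
    have hG : ∀ n, HasGaussianLaw (S n) P := fun n => hX.gaussian.hasGaussianLaw_fun_sum
    have hmean : ∀ n, ∫ ω, S n ω ∂P = 0 := fun n => by
      rw [integral_finsetSum _ fun i _ => (hX.memLp_two i).integrable one_le_two]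
      simp [hX.integral_eq_zero]
    refine tendstoInDistribution_of_map_eq_gaussianReal
      (v := fun n => ((b n * ∑ j, α j) ^ 2 * Var[S n; P]).toNNReal)
      (fun n => (hG n).aemeasurable.const_mul _) (fun n => ?_) ?_
    · have h1 := (hG n).map_eq_gaussianReal
      rw [hmean] at h1
      have h2 : P.map (fun ω => b n * (∑ j, α j) * S n ω) =
          (P.map (S n)).map (fun x => b n * (∑ j, α j) * x) := by
        rw [AEMeasurable.map_map_of_aemeasurable (by fun_prop) (hG n).aemeasurable]
        rfl
      rw [h2, h1, gaussianReal_map_const_mul, mul_zero]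
      congr 1
      ext
      simp [Real.toNNReal_mul, sq_nonneg, variance_nonneg]
    · refine (continuous_real_toNNReal.tendsto _).comp ?_
      refine ((hX.tendsto_variance_sum_div hD0 hD1 hr).mul_const ((∑ j, α j) ^ 2)).congr' ?_
      filter_upwards [hb] with n hn
      rw [mul_pow, hn]
      ring
  refine tendstoInDistribution_of_tendstoInMeasure_sub _ _ hmain ?_ fun n => ?_
  · have hZ : ((fun n ω => b n * ∑ i ∈ Finset.range n, (f (window h X i ω) - p)) -
        fun n ω => b n * (∑ j, α j) * S n ω) = fun n ω => b n * (E n ω + G n ω) := by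
      funext n ω
      simp only [Pi.sub_apply, hEdef, hGdef, hgdef, Finset.sum_sub_distrib]
      ring
    rw [hZ]
    refine tendstoInMeasure_zero_of_integral_sq
      (fun n => ((hEL n).add (hGL n)).const_mul _) ?_
    set K : ℝ := (∑ j, α j ^ 2) * (4 * h ^ 3)
    set w : ℕ → ℝ := fun n => (n : ℝ) ^ 2 * cov[X 0, X n; P] with hw
    have hwt : Tendsto w atTop atTop := by
      have := tendsto_natCast_atTop_atTop (R := ℝ).atTop_mul_atTop₀ (hr.tendsto_mul_atTop hD1)
      refine this.congr fun n => ?_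
      simp only [hw]
      ring
    -- `K` bounds the second moment of `E` for every `n`, and `w n → ∞`; the second term is the
    -- Hermite rank two estimate.
    have hlim : Tendsto (fun n => 2 * (K / w n) + 2 * ((∫ ω, G n ω ^ 2 ∂P) / w n)) atTop (𝓝 0) := by
      have h1 := (hwt.const_div_atTop K).const_mul 2
      have h2 := (hX.tendsto_integral_sq_sum_div hD0 hD1 hr hPD hgm hgL hg0 hg1).const_mul 2
      simpa using h1.add h2
    refine tendsto_of_tendsto_of_tendsto_of_le_of_le' tendsto_const_nhds hlim
      (Eventually.of_forall fun n => integral_nonneg fun ω => sq_nonneg _) ?_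
    filter_upwards [hb, hwt.eventually_gt_atTop 0] with n hn hwn
    have iE : Integrable (fun ω => 2 * E n ω ^ 2) P := (hEL n).integrable_sq.const_mul 2
    have iG : Integrable (fun ω => 2 * G n ω ^ 2) P := (hGL n).integrable_sq.const_mul 2
    calc ∫ ω, (b n * (E n ω + G n ω)) ^ 2 ∂P = (1 / w n) * ∫ ω, (E n ω + G n ω) ^ 2 ∂P := by
          simp_rw [mul_pow, hn]
          rw [integral_const_mul]
      _ ≤ (1 / w n) * ∫ ω, (2 * E n ω ^ 2 + 2 * G n ω ^ 2) ∂P := by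
          refine mul_le_mul_of_nonneg_left ?_ (by positivity)
          refine integral_mono ((hEL n).add (hGL n)).integrable_sq (iE.add iG) fun ω => ?_
          beta_reduce
          nlinarith [sq_nonneg (E n ω - G n ω)]
      _ = (1 / w n) * (2 * ∫ ω, E n ω ^ 2 ∂P + 2 * ∫ ω, G n ω ^ 2 ∂P) := by
          rw [integral_add iE iG, integral_const_mul, integral_const_mul]
      _ ≤ (1 / w n) * (2 * K + 2 * ∫ ω, G n ω ^ 2 ∂P) := by
          gcongr
          exact hX.integral_sq_sum_window_sub_le α n
      _ = _ := by ring
  · refine AEMeasurable.const_mul (Finset.aemeasurable_fun_sum _ fun i _ => ?_) _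
    exact (hfm.comp_aemeasurable (hX.aemeasurable_window h i)).sub_const p

end IsStationaryStandardGaussian

/-! ### Ordinal patterns -/

theorem ordinalPattern_const_add {h : ℕ} (c : ℝ) (x : Fin (h + 1) → ℝ) :
    ordinalPattern (fun j => c + x j) = ordinalPattern x := by
  rw [ordinalPattern_eq_iff]
  simpa using (ordinalPattern_eq_iff x (ordinalPattern x)).1 rfl

theorem measurableSet_ordinalPattern_eq {h : ℕ} (π : Equiv.Perm (Fin (h + 1))) :
    MeasurableSet {x : Fin (h + 1) → ℝ | ordinalPattern x = π} := by
  simp only [ordinalPattern_eq_iff, Set.ofPred_forall, Set.ofPred_and]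
  refine MeasurableSet.iInter fun i => MeasurableSet.inter ?_ ?_
  · exact measurableSet_le (measurable_pi_apply _) (measurable_pi_apply _)
  · by_cases hi : π i.castSucc > π i.succ
    · simp [hi]
    · simp only [hi, imp_false]
      exact (measurableSet_eq_fun (f := fun x : Fin (h + 1) → ℝ => x (π i.castSucc))
        (g := fun x => x (π i.succ)) (measurable_pi_apply _) (measurable_pi_apply _)).compl

theorem measurableSet_incrementPattern_eq {h : ℕ} (π : Equiv.Perm (Fin (h + 1))) :
    MeasurableSet {x : Fin h → ℝ | incrementPattern x = π} := by
  have hm : Measurable fun (x : Fin h → ℝ) (i : Fin (h + 1)) =>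
      ∑ j : Fin h with j.castSucc < i, x j :=
    measurable_pi_lambda _ fun i => Finset.measurable_fun_sum _ fun j _ => measurable_pi_apply j
  exact hm (measurableSet_ordinalPattern_eq π)

/-- The sum telescopes. -/
theorem sum_window_increments {Ω : Type*} (ξ : ℕ → Ω → ℝ) {h : ℕ} (i : ℕ) (ω : Ω)
    (j : Fin (h + 1)) :
    ∑ l : Fin h with l.castSucc < j, window h (increments ξ) i ω l = ξ (i + j) ω - ξ i ω := by
  have h1 : ∑ l : Fin h with l.castSucc < j, window h (increments ξ) i ω l =
      ∑ l ∈ Finset.range j, (ξ (i + (l + 1)) ω - ξ (i + l) ω) := by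
    refine Finset.sum_bij (fun l _ => (l : ℕ)) (fun l hl => ?_) (fun _ _ _ _ => Fin.ext)
      (fun m hm => ?_) fun l _ => rfl
    · simpa [Fin.lt_def] using hl
    · have hm' := Finset.mem_range.1 hm
      exact ⟨⟨m, by omega⟩, by simpa [Fin.lt_def] using hm', rfl⟩
  rw [h1, Finset.sum_range_sub fun l => ξ (i + l) ω, add_zero]

theorem ordinalPattern_eq_incrementPattern_window {Ω : Type*} (ξ : ℕ → Ω → ℝ) {h : ℕ} (i : ℕ)
    (ω : Ω) : ordinalPattern (fun j : Fin (h + 1) => ξ (i + j) ω) =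
      incrementPattern (window h (increments ξ) i ω) := by
  have h1 := ordinalPattern_const_add (ξ i ω) fun j : Fin (h + 1) => ξ (i + j) ω - ξ i ω
  simp only [add_sub_cancel] at h1
  simp only [h1, incrementPattern, sum_window_increments]

theorem patternEvent_eq_preimage {Ω : Type*} {h : ℕ} (X : ℕ → Ω → ℝ)
    (π : Equiv.Perm (Fin (h + 1))) :
    patternEvent X π = window h X 0 ⁻¹' {x | incrementPattern x = π} := by
  have h1 : window h X 0 = fun ω (j : Fin h) => X j ω := by
    funext ω j
    simp only [window, zero_add]
  rw [h1]
  rfl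

theorem patternFrequency_eq {Ω : Type*} {h : ℕ} (ξ : ℕ → Ω → ℝ) (π : Equiv.Perm (Fin (h + 1)))
    (n : ℕ) (ω : Ω) : patternFrequency ξ π n ω = (1 / (n : ℝ)) * ∑ i ∈ Finset.range n,
      {x | incrementPattern x = π}.indicator (fun _ => (1 : ℝ)) (window h (increments ξ) i ω) := by
  classical
  simp only [patternFrequency, ordinalPattern_eq_incrementPattern_window, Set.indicator_apply,
    Set.mem_ofPred_eq]

/-- The normalisation, with the factor `1 / n` of the frequency absorbed, is the inverse square root
of `n² r(n)`. -/
theorem sq_normalization {n : ℕ} {ℓ D : ℝ} (hn : 0 < n) (hℓ : 0 < ℓ) :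
    ((n : ℝ) ^ (D / 2) * ℓ ^ (-(1 / 2) : ℝ) * (1 / n)) ^ 2 =
      1 / ((n : ℝ) ^ 2 * (ℓ * (n : ℝ) ^ (-D))) := by
  have hn' : (0 : ℝ) < n := by exact_mod_cast hn
  have h1 : ((n : ℝ) ^ (D / 2)) ^ 2 = ((n : ℝ) ^ (-D))⁻¹ := by
    rw [← Real.rpow_mul_natCast hn'.le, ← Real.rpow_neg hn'.le]
    congr 1
    push_cast
    ring
  have h2 : (ℓ ^ (-(1 / 2) : ℝ)) ^ 2 = ℓ⁻¹ := by
    rw [← Real.rpow_mul_natCast hℓ.le, ← Real.rpow_neg_one]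
    norm_num
  rw [mul_pow, mul_pow, h1, h2, one_div_pow, one_div, one_div, mul_inv, mul_inv]
  ring

end OrdinalPatterns

open OrdinalPatterns

/-! ### The limit theorem for pattern frequencies -/

theorem mainTheorem5 {Ω : Type*} [MeasurableSpace Ω] (P : Measure Ω) [IsProbabilityMeasure P]
    (ξ : ℕ → Ω → ℝ) (hξ : ∀ t, AEMeasurable (ξ t) P)
    (hX : IsStationaryStandardGaussian (increments ξ) P)
    (D : ℝ) (hD0 : 0 < D) (hD1 : D < 1) (L : ℝ → ℝ) (hL : IsSlowlyVarying L)
    (hr : ∀ k : ℕ, 1 ≤ k →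
      cov[increments ξ 0, increments ξ k; P] = L (k : ℝ) * (k : ℝ) ^ (-D))
    (h : ℕ) (π : Equiv.Perm (Fin (h + 1))) :
    IsUnit (covMatrix (increments ξ) P h).det ∧
    TendstoInDistribution
      (fun (n : ℕ) (ω : Ω) => (n : ℝ) ^ (D / 2) * (L (n : ℝ)) ^ (-(1 / 2) : ℝ) *
        (patternFrequency ξ π n ω - P.real (patternEvent (increments ξ) π)))
      atTop (id : ℝ → ℝ) (fun _ => P)
      (gaussianReal 0 (Real.toNNReal
        (2 / ((1 - D) * (2 - D)) * (∑ j, patternAlpha (increments ξ) P π j) ^ 2))) := by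
  set X := increments ξ with hXdef
  set A : Set (Fin h → ℝ) := {x | incrementPattern x = π} with hA
  have hAm : MeasurableSet A := measurableSet_incrementPattern_eq π
  have hreg : RegularlyVarying (fun k => cov[X 0, X k; P]) D :=
    hL.regularlyVarying ((eventually_ge_atTop 1).mono hr)
  have hdet : IsUnit (covMatrix X P h).det :=
    (hX.posDef_covMatrix (hreg.tendsto_zero hD0) h).det_pos.ne'.isUnit
  refine ⟨hdet, ?_⟩
  have hpre : patternEvent X π = window h X 0 ⁻¹' A := patternEvent_eq_preimage X π
  have hind : ∀ ω, A.indicator (fun _ => (1 : ℝ)) (window h X 0 ω) =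
      (patternEvent X π).indicator (fun _ => (1 : ℝ)) ω := fun ω => by
    rw [hpre]
    rfl
  have hnull : NullMeasurableSet (patternEvent X π) P := by
    rw [hpre]
    exact (hX.aemeasurable_window h 0).nullMeasurable hAm
  have hfm : Measurable (A.indicator fun _ => (1 : ℝ)) := measurable_const.indicator hAm
  have hf : MemLp (fun ω => A.indicator (fun _ => (1 : ℝ)) (window h X 0 ω)) 2 P := by
    refine MemLp.of_bound (hfm.comp_aemeasurable (hX.aemeasurable_window h 0)).aestronglyMeasurable
      1 (Eventually.of_forall fun ω => ?_)
    exact (norm_indicator_le_norm_self _ _).trans norm_one.le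
  obtain ⟨a, -, ha⟩ := hL.1
  have hb : ∀ᶠ n : ℕ in atTop, ((n : ℝ) ^ (D / 2) * L n ^ (-(1 / 2) : ℝ) * (1 / n)) ^ 2 =
      1 / ((n : ℝ) ^ 2 * cov[X 0, X n; P]) := by
    filter_upwards [eventually_ge_atTop 1, tendsto_natCast_atTop_atTop.eventually_ge_atTop a]
      with n hn hna
    rw [hr n hn]
    exact sq_normalization hn (ha _ hna)
  -- Here `f` is the indicator of the pattern set, and `α = Σ⁻¹ c` solves the normal equations
  -- because `Σ` is invertible.
  have key := hX.tendstoInDistribution_sum_window hD0 hD1 hreg hfm hf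
    (p := P.real (patternEvent X π)) (α := patternAlpha X P π)
    (by simp_rw [hind]
        rw [integral_indicator₀ hnull]
        simp)
    (fun i => by
      simp_rw [hind]
      rw [patternAlpha, Matrix.mulVec_mulVec, Matrix.mul_nonsing_inv _ hdet, Matrix.one_mulVec]
      rfl) hb
  have hmeas : ∀ n : ℕ, AEMeasurable (fun ω => (n : ℝ) ^ (D / 2) * L n ^ (-(1 / 2) : ℝ) *
      (patternFrequency ξ π n ω - P.real (patternEvent X π))) P := fun n => by
    simp_rw [patternFrequency_eq]
    refine AEMeasurable.const_mul (AEMeasurable.sub_const (AEMeasurable.const_mul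
      (Finset.aemeasurable_fun_sum _ fun i _ => ?_) _) _) _
    exact hfm.comp_aemeasurable (hX.aemeasurable_window h i)
  -- For `n > 0` the two sequences coincide once `1 / n` is factored out, so their difference is
  -- eventually zero.
  refine tendstoInDistribution_of_tendstoInMeasure_sub _ _ key ?_ hmeas
  refine TendstoInMeasure.congr' (f := fun _ => 0) ?_ EventuallyEq.rfl
    (tendstoInMeasure_zero_of_integral_sq (fun _ => MemLp.zero) (by simp))
  filter_upwards [eventually_gt_atTop 0] with n hn
  refine Eventually.of_forall fun ω => ?_
  have hn' : (n : ℝ) ≠ 0 := by positivity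
  simp only [Pi.sub_apply, patternFrequency_eq, Finset.sum_sub_distrib, Finset.sum_const,
    Finset.card_range, nsmul_eq_mul]
  rw [Pi.zero_apply, eq_comm, sub_eq_zero]
  simp only [← hXdef, ← hA]
  field_simp
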